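/- **Setting.** Let $I=I_0\sqcup I_1$ be the finite vertex set and $\Omega$ the finite set of arrows of a bipartite quiver whose arrows $h$ all go from a source $s(h)\in I_1$ to a sink $t(h)\in I_0$ (multiple arrows are allowed). Let $w=(w_i,w_i')_{i\in I}$ and $v=(v_i)_{i\in I}$ have entries in $\mathbb Z_{\ge 0}$, and let $W_i=\mathbb C^{w_i}$, $W'_i=\mathbb C^{w'_i}$. Let $\mathbf E_w$ be the affine space of tuples $(x_i,y_h)_{i\in I,h\in\Omega}$ of linear maps $x_\alpha:W'_\alpha\to W_\alpha$ ($\alpha\in I_0$), $x_\beta:W_\beta\to W'_\beta$ ($\beta\in I_1$), $y_h:W_{s(h)}\to W_{t(h)}$. Such a tuple determines the linear maps $$A_\alpha=x_\alpha+\sum_{t(h)=\alpha}y_h:\ W'_\alpha\oplus\bigoplus_{t(h)=\alpha}W_{s(h)}\to W_\alpha\ (\alpha\in I_0),\qquad A_\beta=\Big(x_\beta,(y_h)_{s(h)=\beta}\Big):\ W_\beta\to W'_\beta\oplus\bigoplus_{s(h)=\beta}W_{t(h)}\ (\beta\in I_1).$$ Define the varieties (all complex varieties, with reduced structure) $$\mathbf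 E_{v,w}=\{(x_i,y_h)\in\mathbf E_w:\operatorname{rank}A_i\le v_i\ \forall i\in I\},\qquad \mathbf E^\circ_{v,w}=\{(x_i,y_h)\in\mathbf E_w:\operatorname{rank}A_i=v_i\ \forall i\in I\},$$ let $\mathcal F_{v,w}$ be the variety of tuples $(X_i)_{i\in I}$ of linear subspaces with $\dim X_i=v_i$ for all $i$, $X_\alpha\subseteq W_\alpha$ for $\alpha\in I_0$ and $X_\beta\subseteq W'_\beta\oplus\bigoplus_{s(h)=\beta}X_{t(h)}$ for $\beta\in I_1$ (a closed subvariety of a product of Grassmannians), and let $$\tilde{\mathcal F}_{v,w}=\{(x_i,y_h,X_i)\in\mathbf E_w\times\mathcal F_{v,w}:\operatorname{im}A_i\subseteq X_i\ \forall i\in I\},\qquad \pi:\tilde{\mathcal F}_{v,w}\to\mathbf E_{v,w},\ (x_i,y_h,X_i)\mapsto(x_i,y_h).$$ Put $C_qv=(u_i,u_i')_{i\in I}$ with $u_i=v_i$ and $u'_i=v_i-\sum_{h}v_j$, the sum being over all arrows $h$ with an endpoint $i$, where $j$ is the other endpoint of $h$. Dimension vectors are compared componentwise, and $\mathbb C^*$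 acts on $\mathbf E_w$ by multiplying all $x_i,y_h$ by the same scalar. **Lemma 4.3 (Algebraic Transversal Slice Theorem).** Let $p\in\mathbf E_{v,w}$ be a point of the stratum $\mathbf E^\circ_{v^0,w}$. Then $v^0\le v$, and $w^\perp:=w-C_qv^0$ has nonnegative entries. Put $v^\perp:=v-v^0$ and $U^\perp:=\mathbf E_{v^\perp,w^\perp}$, so that $\pi^{-1}(U^\perp)=\tilde{\mathcal F}_{v^\perp,w^\perp}$. There exist $\mathbb C^*$-invariant Zariski open neighborhoods $U$ of $p$ in $\mathbf E_{v,w}$ and $U^0$ of $p$ in $\mathbf E^\circ_{v^0,w}$, and isomorphisms of varieties $$\varphi:\pi^{-1}(U)\xrightarrow{\ \cong\ }U^0\times\pi^{-1}(U^\perp),\qquad \psi:U\xrightarrow{\ \cong\ }U^0\times U^\perp,$$ such that $\psi\circ\pi=(1\times\pi)\circ\varphi$ on $\pi^{-1}(U)$, $\psi(p)=(p,0)$, and $$\psi\big(\mathbf E^\circ_{u,w}\cap U\big)=U^0\times\mathbf E^\circ_{u-v^0,\,w^\perp}\qquad\text{for every }u\text{ with }v^0\le u\le v.$$ -/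

import Mathlib

/-! ### Classical varieties as spaces with functions -/

/-- A space with functions over `ℂ`: a topological space together with a sheaf of `ℂ`-algebras of
`ℂ`-valued functions in which a function without zeros is invertible and has open non-vanishing
locus.  The sheaf is recorded by the predicate `RegularAt f x`; it only depends on the germ of `f`
at `x`, and the regular functions on an open set `U` are the functions regular at all points
of `U`.  Complex algebraic varieties (sets of closed points with their Zariski topology and their
regular functions) are such spaces, and a morphism of varieties is the same thing as a morphism of
spaces with functions. The topology is deliberately not a `TopologicalSpace` instance: on `ℂ`, on
products and so on it differs from the usual one. -/
class SpaceWithFunctions (X : Type*) where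
  zariski : TopologicalSpace X
  RegularAt : (X → ℂ) → X → Prop
  const : ∀ (c : ℂ) (x : X), RegularAt (fun _ => c) x
  add : ∀ {f g : X → ℂ} {x : X}, RegularAt f x → RegularAt g x →
    RegularAt (fun y => f y + g y) x
  mul : ∀ {f g : X → ℂ} {x : X}, RegularAt f x → RegularAt g x →
    RegularAt (fun y => f y * g y) x
  inv : ∀ {f : X → ℂ} {x : X}, RegularAt f x → f x ≠ 0 → RegularAt (fun y => (f y)⁻¹) x
  congr : ∀ {f g : X → ℂ} {x : X}, RegularAt f x →
    (∃ V, zariski.IsOpen V ∧ x ∈ V ∧ ∀ y ∈ V, f y = g y) → RegularAt g x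
  spread : ∀ {f : X → ℂ} {x : X}, RegularAt f x →
    ∃ V, zariski.IsOpen V ∧ x ∈ V ∧ ∀ y ∈ V, RegularAt f y
  ne_zero : ∀ {f : X → ℂ} {x : X}, RegularAt f x → f x ≠ 0 →
    ∃ V, zariski.IsOpen V ∧ x ∈ V ∧ ∀ y ∈ V, f y ≠ 0

namespace SpaceWithFunctions

/-- Zariski open sets. -/
def IsZariskiOpen {X : Type*} [S : SpaceWithFunctions X] (U : Set X) : Prop :=
  S.zariski.IsOpen U

/-- `f` is a regular function on the set `U`. -/
def RegularOn {X : Type*} [SpaceWithFunctions X] (f : X → ℂ) (U : Set X) : Prop :=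
  ∀ x ∈ U, RegularAt f x

/-- Morphisms: continuous maps that pull regular functions back to regular functions. -/
structure IsMorphism {X Y : Type*} [SpaceWithFunctions X] [SpaceWithFunctions Y]
    (f : X → Y) : Prop where
  continuous : ∀ V : Set Y, IsZariskiOpen V → IsZariskiOpen (f ⁻¹' V)
  regular : ∀ (g : Y → ℂ) (x : X), RegularAt g (f x) → RegularAt (fun z => g (f z)) x

/-- Isomorphisms: bijections that are morphisms in both directions. -/
structure Iso (X Y : Type*) [SpaceWithFunctions X] [SpaceWithFunctions Y] extends X ≃ Y where
  isMorphism_toFun : IsMorphism toFun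
  isMorphism_invFun : IsMorphism invFun

/-- Finite sums and products of functions of a family `B` of locally defined functions.  Here
`Basic B V f` means that `f` is defined on `V` by such an expression. -/
inductive Basic {X : Type*} (B : Set (Set X × (X → ℂ))) : Set X → (X → ℂ) → Prop
  | of {V : Set X} {f : X → ℂ} : (V, f) ∈ B → Basic B V f
  | const (c : ℂ) : Basic B Set.univ (fun _ => c)
  | add {V V' : Set X} {f g : X → ℂ} : Basic B V f → Basic B V' g →
      Basic B (V ∩ V') (fun y => f y + g y)
  | mul {V V' : Set X} {f g : X → ℂ} : Basic B V f → Basic B V' g →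
      Basic B (V ∩ V') (fun y => f y * g y)

/-- The topology with basis the sets `{x ∈ V | f x ≠ 0}`, where `f` is a sum of products of
functions of `B` and is defined on `V`. -/
@[reducible]
def genTop {X : Type*} (B : Set (Set X × (X → ℂ))) : TopologicalSpace X :=
  TopologicalSpace.generateFrom {S | ∃ V f, Basic B V f ∧ S = {x | x ∈ V ∧ f x ≠ 0}}

theorem genTop_basic {X : Type*} {B : Set (Set X × (X → ℂ))} {V : Set X} {f : X → ℂ}
    (h : Basic B V f) : (genTop B).IsOpen {x | x ∈ V ∧ f x ≠ 0} :=
  TopologicalSpace.GenerateOpen.basic _ ⟨V, f, h, rfl⟩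

/-- The coarsest space with functions for which every `(V, f) ∈ B` is a function `f` regular on
the open set `V` (if `V` is open in the generated topology): a function is regular at `x` if on
a neighbourhood `W` of `x` it is a quotient `g / h` of sums of products of functions of `B`. -/
@[reducible]
def generated {X : Type*} (B : Set (Set X × (X → ℂ))) : SpaceWithFunctions X where
  zariski := genTop B
  RegularAt f x := ∃ V V' g h W, Basic B V g ∧ Basic B V' h ∧ (genTop B).IsOpen W ∧ x ∈ W ∧
    ∀ y ∈ W, y ∈ V ∧ y ∈ V' ∧ h y ≠ 0 ∧ f y = g y / h y
  const c x := ⟨Set.univ, Set.univ, fun _ => c, fun _ => 1, Set.univ, .const c, .const 1,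
    (genTop B).isOpen_univ, trivial, fun y _ => ⟨trivial, trivial, one_ne_zero, by simp⟩⟩
  add := by
    rintro f f' x ⟨V, V', g, h, W, hg, hh, hW, hxW, H⟩ ⟨T, T', k, l, W', hk, hl, hW', hxW', H'⟩
    refine ⟨_, _, _, _, W ∩ W', (hg.mul hl).add (hk.mul hh), hh.mul hl,
      (genTop B).isOpen_inter _ _ hW hW', ⟨hxW, hxW'⟩, ?_⟩
    rintro y ⟨hy, hy'⟩
    obtain ⟨a1, a2, a3, a4⟩ := H y hy
    obtain ⟨b1, b2, b3, b4⟩ := H' y hy'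
    refine ⟨⟨⟨a1, b2⟩, b1, a2⟩, ⟨a2, b2⟩, mul_ne_zero a3 b3, ?_⟩
    simp only [a4, b4]
    field_simp
  mul := by
    rintro f f' x ⟨V, V', g, h, W, hg, hh, hW, hxW, H⟩ ⟨T, T', k, l, W', hk, hl, hW', hxW', H'⟩
    refine ⟨_, _, _, _, W ∩ W', hg.mul hk, hh.mul hl,
      (genTop B).isOpen_inter _ _ hW hW', ⟨hxW, hxW'⟩, ?_⟩
    rintro y ⟨hy, hy'⟩
    obtain ⟨a1, a2, a3, a4⟩ := H y hy
    obtain ⟨b1, b2, b3, b4⟩ := H' y hy'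
    refine ⟨⟨a1, b1⟩, ⟨a2, b2⟩, mul_ne_zero a3 b3, ?_⟩
    simp only [a4, b4]
    field_simp
  inv := by
    rintro f x ⟨V, V', g, h, W, hg, hh, hW, hxW, H⟩ hfx
    have hgx : g x ≠ 0 := fun h0 => hfx (by rw [(H x hxW).2.2.2, h0, zero_div])
    refine ⟨V', V, h, g, W ∩ {y | y ∈ V ∧ g y ≠ 0}, hh, hg,
      (genTop B).isOpen_inter _ _ hW (genTop_basic hg), ⟨hxW, (H x hxW).1, hgx⟩, ?_⟩
    rintro y ⟨hy, hyV, hgy⟩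
    obtain ⟨a1, a2, a3, a4⟩ := H y hy
    exact ⟨a2, a1, hgy, by simp only [a4, inv_div]⟩
  congr := by
    rintro f f' x ⟨V, V', g, h, W, hg, hh, hW, hxW, H⟩ ⟨T, hT, hxT, hTf⟩
    refine ⟨V, V', g, h, W ∩ T, hg, hh, (genTop B).isOpen_inter _ _ hW hT, ⟨hxW, hxT⟩, ?_⟩
    rintro y ⟨hy, hyT⟩
    rw [← hTf y hyT]
    exact H y hy
  spread := by
    rintro f x ⟨V, V', g, h, W, hg, hh, hW, hxW, H⟩
    exact ⟨W, hW, hxW, fun y hy => ⟨V, V', g, h, W, hg, hh, hW, hy, H⟩⟩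
  ne_zero := by
    rintro f x ⟨V, V', g, h, W, hg, hh, hW, hxW, H⟩ hfx
    have hgx : g x ≠ 0 := fun h0 => hfx (by rw [(H x hxW).2.2.2, h0, zero_div])
    refine ⟨W ∩ {y | y ∈ V ∧ g y ≠ 0},
      (genTop B).isOpen_inter _ _ hW (genTop_basic hg), ⟨hxW, (H x hxW).1, hgx⟩, ?_⟩
    rintro y ⟨hy, hyV, hgy⟩
    obtain ⟨a1, a2, a3, a4⟩ := H y hy
    rw [a4]
    exact div_ne_zero hgy a3

/-- The pullbacks along `p : X → Y` of the regular functions on open subsets of `Y`. -/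
def pullback {X Y : Type*} [SpaceWithFunctions Y] (p : X → Y) : Set (Set X × (X → ℂ)) :=
  {b | ∃ (U : Set Y) (g : Y → ℂ), IsZariskiOpen U ∧ RegularOn g U ∧
    b = (p ⁻¹' U, fun x => g (p x))}

/-- The affine line: regular functions are locally quotients of polynomials. -/
instance affineLine : SpaceWithFunctions ℂ := generated {(Set.univ, fun z => z)}

/-- Subsets carry the induced topology and the functions that are locally restrictions of regular
functions: for a locally closed subset this is its (reduced) structure of a subvariety. -/
instance subspace {X : Type*} [SpaceWithFunctions X] (p : X → Prop) :
    SpaceWithFunctions (Subtype p) :=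
  generated (pullback Subtype.val)

/-- The product in the category of spaces with functions, which for varieties is the product of
varieties: regular functions are locally quotients of sums of `f(x) g(y)`, and the sets where such
a sum does not vanish form a basis of the topology. -/
instance prod {X Y : Type*} [SpaceWithFunctions X] [SpaceWithFunctions Y] :
    SpaceWithFunctions (X × Y) :=
  generated (pullback Prod.fst ∪ pullback Prod.snd)

/-- Products of families, in the same way.  In particular `Fin n → ℂ` is affine `n`-space. -/
instance pi {ι : Type*} {Y : ι → Type*} [∀ i, SpaceWithFunctions (Y i)] :
    SpaceWithFunctions (∀ i, Y i) :=
  generated (⋃ i, pullback (fun y : ∀ i, Y i => y i))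

/-- A space of matrices is an affine space. -/
instance matrix {m n : Type*} : SpaceWithFunctions (Matrix m n ℂ) :=
  inferInstanceAs (SpaceWithFunctions (m → n → ℂ))

/-- The quotient structure along `q : X → Y`: a set is open, respectively a function is regular
on an open set, if its pullback along `q` is. -/
@[reducible]
def quotient {X Y : Type*} [S : SpaceWithFunctions X] (q : X → Y) : SpaceWithFunctions Y where
  zariski := TopologicalSpace.coinduced q S.zariski
  RegularAt f y := ∃ V : Set Y, S.zariski.IsOpen (q ⁻¹' V) ∧ y ∈ V ∧
    ∀ x, q x ∈ V → S.RegularAt (fun z => f (q z)) x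
  const c y := ⟨Set.univ, S.zariski.isOpen_univ, trivial, fun x _ => S.const c x⟩
  add := by
    rintro f g y ⟨V, hV, hy, H⟩ ⟨W, hW, hy', H'⟩
    exact ⟨V ∩ W, S.zariski.isOpen_inter _ _ hV hW, ⟨hy, hy'⟩,
      fun x hx => S.add (H x hx.1) (H' x hx.2)⟩
  mul := by
    rintro f g y ⟨V, hV, hy, H⟩ ⟨W, hW, hy', H'⟩
    exact ⟨V ∩ W, S.zariski.isOpen_inter _ _ hV hW, ⟨hy, hy'⟩,
      fun x hx => S.mul (H x hx.1) (H' x hx.2)⟩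
  inv := by
    rintro f y ⟨V, hV, hy, H⟩ hfy
    refine ⟨V ∩ {z | f z ≠ 0}, ?_, ⟨hy, hfy⟩, fun x hx => S.inv (H x hx.1) hx.2⟩
    refine (@isOpen_iff_forall_mem_open X S.zariski _).2 ?_
    rintro x ⟨hx, hfx⟩
    obtain ⟨T, hT, hxT, HT⟩ := S.ne_zero (H x hx) hfx
    exact ⟨q ⁻¹' V ∩ T, fun z hz => ⟨hz.1, HT z hz.2⟩, S.zariski.isOpen_inter _ _ hV hT, hx, hxT⟩
  congr := by
    rintro f g y ⟨V, hV, hy, H⟩ ⟨W, hW, hy', HW⟩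
    refine ⟨V ∩ W, S.zariski.isOpen_inter _ _ hV hW, ⟨hy, hy'⟩, fun x hx => ?_⟩
    exact S.congr (H x hx.1) ⟨q ⁻¹' W, hW, hx.2, fun z hz => HW _ hz⟩
  spread := by
    rintro f y ⟨V, hV, hy, H⟩
    exact ⟨V, hV, hy, fun z hz => ⟨V, hV, hz, H⟩⟩
  ne_zero := by
    rintro f y ⟨V, hV, hy, H⟩ hfy
    refine ⟨V ∩ {z | f z ≠ 0}, ?_, ⟨hy, hfy⟩, fun z hz => hz.2⟩
    refine (@isOpen_iff_forall_mem_open X S.zariski _).2 ?_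
    rintro x ⟨hx, hfx⟩
    obtain ⟨T, hT, hxT, HT⟩ := S.ne_zero (H x hx) hfx
    exact ⟨q ⁻¹' V ∩ T, fun z hz => ⟨hz.1, HT z hz.2⟩, S.zariski.isOpen_inter _ _ hV hT, hx, hxT⟩

end SpaceWithFunctions

/-! ### Grassmannians -/

/-- The set of `d`-dimensional linear subspaces of `ℂ^ι`. -/
@[ext]
structure Gr (d : ℕ) (ι : Type*) where
  space : Submodule ℂ (ι → ℂ)
  finrank_eq : Module.finrank ℂ space = d

/-- Linearly independent `d`-tuples in `ℂ^ι`. -/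
abbrev Frame (d : ℕ) (ι : Type*) := {b : Fin d → ι → ℂ // LinearIndependent ℂ b}

/-- The span of a frame. -/
def Frame.toGr {d : ℕ} {ι : Type*} (b : Frame d ι) : Gr d ι :=
  ⟨Submodule.span ℂ (Set.range b.1), by simpa using finrank_span_eq_card b.2⟩

/-- The Grassmannian as the quotient of the variety of frames by the general linear group. -/
instance Gr.instSpaceWithFunctions {d : ℕ} {ι : Type*} : SpaceWithFunctions (Gr d ι) :=
  SpaceWithFunctions.quotient (Frame.toGr (d := d) (ι := ι))

/-! ### Graded quiver varieties of a bipartite quiver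

A bipartite quiver is given by the set `I₀` of its sinks, the set `I₁` of its sources, and the set
`Ω β α` of arrows `β → α` for `β : I₁` and `α : I₀`. The set of vertices is `I₀ ⊕ I₁`. -/

/-- A dimension vector `w = (w_i, w'_i)`. -/
structure FrameDim (I : Type*) where
  dim : I → ℕ
  dim' : I → ℕ

namespace QuiverVariety

open Sum

variable {I₀ I₁ : Type*} (Ω : I₁ → I₀ → Type*)

/-- The space `E_w` of representations `(x_i, y_h)` of the decorated quiver; `q.1 α : W'_α → W_α`
for sinks `α`, `q.2.1 β : W_β → W'_β` for sources `β`, and `q.2.2 β α h : W_β → W_α` for arrows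
`h : β → α`. -/
abbrev RepSpace (w : FrameDim (I₀ ⊕ I₁)) :=
  (∀ α : I₀, Matrix (Fin (w.dim (inl α))) (Fin (w.dim' (inl α))) ℂ) ×
  (∀ β : I₁, Matrix (Fin (w.dim' (inr β))) (Fin (w.dim (inr β))) ℂ) ×
  (∀ (β : I₁) (α : I₀), Ω β α → Matrix (Fin (w.dim (inl α))) (Fin (w.dim (inr β))) ℂ)

/-- Coordinates on `W'_α ⊕ ⨁_{h : t(h) = α} W_{s(h)}`, for a sink `α`. -/
abbrev SinkIndex (w : FrameDim (I₀ ⊕ I₁)) (α : I₀) :=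
  Fin (w.dim' (inl α)) ⊕ Σ (β : I₁) (_ : Ω β α), Fin (w.dim (inr β))

/-- Coordinates on `W'_β ⊕ ⨁_{h : s(h) = β} W_{t(h)}`, for a source `β`. -/
abbrev SourceIndex (w : FrameDim (I₀ ⊕ I₁)) (β : I₁) :=
  Fin (w.dim' (inr β)) ⊕ Σ (α : I₀) (_ : Ω β α), Fin (w.dim (inl α))

variable {Ω} {w : FrameDim (I₀ ⊕ I₁)}

/-- The block matrix `A_α = [x_α | y_h | ⋯]`. -/
def sinkMatrix (q : RepSpace Ω w) (α : I₀) : Matrix (Fin (w.dim (inl α))) (SinkIndex Ω w α) ℂ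
  | i, inl j => q.1 α i j
  | i, inr ⟨β, h, j⟩ => q.2.2 β α h i j

/-- The block matrix `A_β`, with `x_β` and the `y_h` stacked vertically. -/
def sourceMatrix (q : RepSpace Ω w) (β : I₁) : Matrix (SourceIndex Ω w β) (Fin (w.dim (inr β))) ℂ
  | inl i, j => q.2.1 β i j
  | inr ⟨α, h, i⟩, j => q.2.2 β α h i j

variable (Ω)

/-- The product of Grassmannians containing `F_{v,w}`. -/
abbrev GrProd (v : I₀ ⊕ I₁ → ℕ) (w : FrameDim (I₀ ⊕ I₁)) :=
  (∀ α : I₀, Gr (v (inl α)) (Fin (w.dim (inl α)))) ×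
  (∀ β : I₁, Gr (v (inr β)) (SourceIndex Ω w β))

/-- The projective variety `F_{v,w}`: tuples of subspaces with
`X_β ⊆ W'_β ⊕ ⨁_{h : s(h) = β} X_{t(h)}` for all sources `β`. -/
def F (v : I₀ ⊕ I₁ → ℕ) (w : FrameDim (I₀ ⊕ I₁)) : Set (GrProd Ω v w) :=
  {X | ∀ β, ∀ ξ ∈ (X.2 β).space, ∀ (α : I₀) (h : Ω β α),
    (fun k => ξ (inr ⟨α, h, k⟩)) ∈ (X.1 α).space}

variable [Fintype I₀] [Fintype I₁] [∀ β α, Fintype (Ω β α)]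

/-- The nonsingular graded quiver variety: pairs of `(x_i, y_h) ∈ E_w` and `(X_i) ∈ F_{v,w}` with
`im A_i ⊆ X_i` for all vertices `i`. -/
def Ftilde (v : I₀ ⊕ I₁ → ℕ) (w : FrameDim (I₀ ⊕ I₁)) : Set (RepSpace Ω w × GrProd Ω v w) :=
  {z | z.2 ∈ F Ω v w ∧
    (∀ α, LinearMap.range (sinkMatrix z.1 α).mulVecLin ≤ (z.2.1 α).space) ∧
    (∀ β, LinearMap.range (sourceMatrix z.1 β).mulVecLin ≤ (z.2.2 β).space)}

variable {Ω} in
/-- The rank of `A_i`. -/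
noncomputable def rankA (q : RepSpace Ω w) : I₀ ⊕ I₁ → ℕ
  | inl α => (sinkMatrix q α).rank
  | inr β => (sourceMatrix q β).rank

/-- The affine graded quiver variety `E_{v,w}`. -/
def E (v : I₀ ⊕ I₁ → ℕ) (w : FrameDim (I₀ ⊕ I₁)) : Set (RepSpace Ω w) :=
  {q | ∀ i, rankA q i ≤ v i}

/-- The stratum `E°_{v,w}`. -/
def Stratum (v : I₀ ⊕ I₁ → ℕ) (w : FrameDim (I₀ ⊕ I₁)) : Set (RepSpace Ω w) :=
  {q | ∀ i, rankA q i = v i}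

variable {Ω} in
/-- The projection `π : (x_i, y_h, X_i) ↦ (x_i, y_h)`. -/
def proj {v : I₀ ⊕ I₁ → ℕ} (z : Ftilde Ω v w) : E Ω v w :=
  ⟨z.1.1, by
    rintro (α | β)
    · exact (Submodule.finrank_mono (z.2.2.1 α)).trans (z.1.2.1 α).finrank_eq.le
    · exact (Submodule.finrank_mono (z.2.2.2 β)).trans (z.1.2.2 β).finrank_eq.le⟩

/-- The `q`-analogue `C_q` of the Cartan matrix: `C_q v = (u_i, u'_i)` with `u_i = v_i` and
`u'_i = v_i - ∑_{h : i - j} v_j`, the sum over all arrows `h` with an endpoint `i`. -/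
def Cq (v : I₀ ⊕ I₁ → ℕ) : I₀ ⊕ I₁ → ℤ × ℤ
  | inl α => (v (inl α), v (inl α) - ∑ β : I₁, ∑ _h : Ω β α, (v (inr β) : ℤ))
  | inr β => (v (inr β), v (inr β) - ∑ α : I₀, ∑ _h : Ω β α, (v (inl α) : ℤ))

end QuiverVariety

/-!
Split off `v₀ i` coordinates of every `W_i` such that the block `M` of `A_i` on these core
coordinates and on `W'_i` is surjective at `p` for a sink and injective at `p` for a source. Both
persist on a `ℂ*`-stable neighbourhood of `p`, where a splitting of `M` depends regularly on the
point. For a sink write `A_α` as `[M, R; N, D]`. Eliminating `M` reduces `A_α` to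
`[N K, D - N Z]`, where `K` is the inclusion of `ker M` and `M Z = R`, so that `A_α` has rank
`v₀ α` plus the rank of this reduction; sources are dual. An arrow occurs at both of its ends, and
one filler `Z_h` serves both, so the reductions are the matrices of one point `perp q`
of `E_{w^⊥}`. Conversely every such point can be glued onto `q` without changing the blocks `M`;
that `perp` and `glue` are mutually inverse makes the neighbourhood the product of the stratum
`perp = 0` with the slice. Finally the reductions at `i` are surjections with kernel contained
in `im A_i`, which they map onto `im A_i^⊥`. So the subspaces containing `im A_i` correspond to
those containing `im A_i^⊥`, and the product decomposition lifts to the subspaces.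
-/

/-! ### Germs of morphisms -/

namespace SpaceWithFunctions

open Filter

/-- The filter of Zariski neighbourhoods of `x`. -/
def zariskiNhds {X : Type*} [SpaceWithFunctions X] (x : X) : Filter X :=
  @nhds X zariski x

/-- `f` is a morphism in a neighbourhood of `x`, expressed through germs at `x`. -/
structure IsMorphismAt {X Y : Type*} [SpaceWithFunctions X] [SpaceWithFunctions Y]
    (f : X → Y) (x : X) : Prop where
  tendsto : Tendsto f (zariskiNhds x) (zariskiNhds (f x))
  regular : ∀ g : Y → ℂ, RegularAt g (f x) → RegularAt (fun z => g (f z)) x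

section Germs

variable {X Y Z T : Type*} [SpaceWithFunctions X] [SpaceWithFunctions Y] [SpaceWithFunctions Z]
  {x : X}

theorem eventually_zariskiNhds_iff {P : X → Prop} :
    (∀ᶠ y in zariskiNhds x, P y) ↔ ∃ V, IsZariskiOpen V ∧ x ∈ V ∧ ∀ y ∈ V, P y := by
  refine (@eventually_nhds_iff X zariski x P).trans (exists_congr fun V => ?_)
  exact ⟨fun ⟨h, hV, hx⟩ => ⟨hV, hx, h⟩, fun ⟨hV, hx, h⟩ => ⟨h, hV, hx⟩⟩

theorem IsZariskiOpen.eventually_mem {U : Set X} (hU : IsZariskiOpen U) (hx : x ∈ U) :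
    ∀ᶠ y in zariskiNhds x, y ∈ U :=
  eventually_zariskiNhds_iff.2 ⟨U, hU, hx, fun _ hy => hy⟩

theorem isZariskiOpen_iff_eventually {U : Set X} :
    IsZariskiOpen U ↔ ∀ x ∈ U, ∀ᶠ y in zariskiNhds x, y ∈ U :=
  @isOpen_iff_eventually X zariski U

theorem self_of_eventually {P : X → Prop} (h : ∀ᶠ y in zariskiNhds x, P y) : P x :=
  @Eventually.self_of_nhds X zariski x P h

theorem RegularAt.congr_of_eventuallyEq {f g : X → ℂ} (hf : RegularAt f x)
    (h : f =ᶠ[zariskiNhds x] g) : RegularAt g x :=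
  SpaceWithFunctions.congr hf (eventually_zariskiNhds_iff.1 h)

theorem RegularAt.eventually_ne_zero {f : X → ℂ} (hf : RegularAt f x) (hx : f x ≠ 0) :
    ∀ᶠ y in zariskiNhds x, f y ≠ 0 :=
  eventually_zariskiNhds_iff.2 (ne_zero hf hx)

theorem isMorphism_of_isMorphismAt {f : X → Y} (h : ∀ x, IsMorphismAt f x) : IsMorphism f where
  continuous _ hV := isZariskiOpen_iff_eventually.2 fun x hx =>
    (h x).tendsto.eventually (hV.eventually_mem hx)
  regular g x hg := (h x).regular g hg

theorem IsMorphismAt.comp {g : Y → Z} {f : X → Y} (hg : IsMorphismAt g (f x))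
    (hf : IsMorphismAt f x) : IsMorphismAt (fun y => g (f y)) x where
  tendsto := hg.tendsto.comp hf.tendsto
  regular k hk := hf.regular _ (hg.regular k hk)

theorem IsMorphismAt.const (c : Y) : IsMorphismAt (fun _ : X => c) x where
  tendsto := tendsto_const_pure.mono_right fun U hU =>
    self_of_eventually (P := (· ∈ U)) hU
  regular g _ := SpaceWithFunctions.const (g c) x

theorem IsMorphismAt.congr_of_eventuallyEq {f g : X → Y} (hf : IsMorphismAt f x)
    (h : f =ᶠ[zariskiNhds x] g) : IsMorphismAt g x where
  tendsto := self_of_eventually h ▸ hf.tendsto.congr' h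
  regular k hk := (hf.regular k (by rwa [self_of_eventually h])).congr_of_eventuallyEq
    (h.fun_comp k)

theorem basic_germ {B : Set (Set T × (T → ℂ))} {f : X → T}
    (h : ∀ V g, (V, g) ∈ B → f x ∈ V →
      (∀ᶠ y in zariskiNhds x, f y ∈ V) ∧ RegularAt (fun y => g (f y)) x)
    {V : Set T} {g : T → ℂ} (hb : Basic B V g) (hx : f x ∈ V) :
    (∀ᶠ y in zariskiNhds x, f y ∈ V) ∧ RegularAt (fun y => g (f y)) x := by
  induction hb with
  | of hB => exact h _ _ hB hx
  | const c => exact ⟨.of_forall fun _ => trivial, const c x⟩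
  | add _ _ ih ih' => exact ⟨(ih hx.1).1.and (ih' hx.2).1, add (ih hx.1).2 (ih' hx.2).2⟩
  | mul _ _ ih ih' => exact ⟨(ih hx.1).1.and (ih' hx.2).1, mul (ih hx.1).2 (ih' hx.2).2⟩

theorem IsMorphismAt.of_generated {B : Set (Set T × (T → ℂ))} {f : X → T}
    (h : ∀ V g, (V, g) ∈ B → f x ∈ V →
      (∀ᶠ y in zariskiNhds x, f y ∈ V) ∧ RegularAt (fun y => g (f y)) x) :
    @IsMorphismAt X T _ (generated B) f x := by
  let := generated B
  have hlim : Tendsto f (zariskiNhds x) (zariskiNhds (f x)) := by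
    refine TopologicalSpace.tendsto_nhds_generateFrom_iff.2 ?_
    rintro _ ⟨V, g, hb, rfl⟩ ⟨hxV, hgx⟩
    obtain ⟨hV, hg⟩ := basic_germ h hb hxV
    exact hV.and (hg.eventually_ne_zero hgx)
  refine ⟨hlim, ?_⟩
  rintro g ⟨V, V', k, l, W, hk, hl, hW, hxW, hquot⟩
  obtain ⟨hxV, hxV', hlx, -⟩ := hquot _ hxW
  refine RegularAt.congr_of_eventuallyEq
    (mul (basic_germ h hk hxV).2 (inv (basic_germ h hl hxV').2 hlx)) ?_
  filter_upwards [hlim.eventually (IsZariskiOpen.eventually_mem hW hxW)] with y hy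
  rw [(hquot _ hy).2.2.2, div_eq_mul_inv]

theorem IsMorphismAt.of_pullback_subset {B : Set (Set T × (T → ℂ))} {p : T → Y}
    (hB : pullback p ⊆ B) (t : T) : @IsMorphismAt T Y (generated B) _ p t := by
  let := generated B
  have hopen : ∀ V : Set Y, IsZariskiOpen V → IsZariskiOpen (p ⁻¹' V) := fun V hV => by
    have h := genTop_basic
      (.of (hB ⟨V, fun _ => 1, hV, fun x _ => SpaceWithFunctions.const 1 x, rfl⟩))
    simp only [ne_eq, one_ne_zero, not_false_eq_true, and_true] at h
    exact h
  refine ⟨fun U hU => ?_, ?_⟩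
  · obtain ⟨V, hV, hx, hVU⟩ := eventually_zariskiNhds_iff.1 hU
    exact ((hopen V hV).eventually_mem hx).mono fun y hy => hVU (p y) hy
  · intro g hg
    obtain ⟨V, hV, hx, hgV⟩ := spread hg
    exact ⟨p ⁻¹' V, Set.univ, fun s => g (p s), fun _ => 1, p ⁻¹' V,
      .of (hB ⟨V, g, hV, hgV, rfl⟩), .const 1, hopen V hV, hx,
      fun y hy => ⟨hy, trivial, one_ne_zero, by rw [div_one]⟩⟩

theorem IsMorphismAt.germ_of_mem_pullback {p : T → Y} {f : X → T}
    (hf : IsMorphismAt (fun y => p (f y)) x) {V : Set T} {g : T → ℂ} (hb : (V, g) ∈ pullback p)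
    (hx : f x ∈ V) : (∀ᶠ y in zariskiNhds x, f y ∈ V) ∧ RegularAt (fun y => g (f y)) x := by
  obtain ⟨U, k, hU, hk, h⟩ := hb
  obtain ⟨rfl, rfl⟩ := Prod.mk.inj h
  exact ⟨hf.tendsto.eventually (hU.eventually_mem hx), hf.regular k (hk _ hx)⟩

theorem IsMorphismAt.val {p : X → Prop} {f : Z → Subtype p} {z : Z} (hf : IsMorphismAt f z) :
    IsMorphismAt (fun y => (f y).1) z :=
  (IsMorphismAt.of_pullback_subset subset_rfl (f z)).comp hf

theorem IsMorphismAt.of_val {p : Y → Prop} {f : X → Subtype p}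
    (hf : IsMorphismAt (fun y => (f y).1) x) : IsMorphismAt f x :=
  .of_generated fun _ _ => hf.germ_of_mem_pullback

theorem isMorphismAt_id (x : X) : IsMorphismAt (fun y => y) x :=
  ⟨tendsto_id, fun _ hg => hg⟩

theorem IsMorphismAt.fst {f : Z → X × Y} {z : Z} (hf : IsMorphismAt f z) :
    IsMorphismAt (fun y => (f y).1) z :=
  (IsMorphismAt.of_pullback_subset Set.subset_union_left (f z)).comp hf

theorem IsMorphismAt.snd {f : Z → X × Y} {z : Z} (hf : IsMorphismAt f z) :
    IsMorphismAt (fun y => (f y).2) z :=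
  (IsMorphismAt.of_pullback_subset Set.subset_union_right (f z)).comp hf

theorem IsMorphismAt.prodMk {f : Z → X} {g : Z → Y} {z : Z} (hf : IsMorphismAt f z)
    (hg : IsMorphismAt g z) : IsMorphismAt (fun y => (f y, g y)) z :=
  .of_generated fun _ _ hb hx => hb.elim
    (fun hb => hf.germ_of_mem_pullback (p := Prod.fst) hb hx)
    (fun hb => hg.germ_of_mem_pullback (p := Prod.snd) hb hx)

theorem isMorphismAt_pi_iff {ι : Type*} {T : ι → Type*} [∀ i, SpaceWithFunctions (T i)]
    {f : Z → ∀ i, T i} {z : Z} : IsMorphismAt f z ↔ ∀ i, IsMorphismAt (fun y => f y i) z := by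
  refine ⟨fun hf i => ?_, fun hf => .of_generated fun V g hb => ?_⟩
  · exact (IsMorphismAt.of_pullback_subset
      (Set.subset_iUnion (fun i => pullback fun y : ∀ i, T i => y i) i) (f z)).comp hf
  · obtain ⟨i, hi⟩ := Set.mem_iUnion.1 hb
    exact (hf i).germ_of_mem_pullback (p := fun y : ∀ i, T i => y i) hi

theorem regularAt_id (c : ℂ) : RegularAt (fun z : ℂ => z) c :=
  ⟨Set.univ, Set.univ, fun z => z, fun _ => 1, Set.univ, .of rfl, .const 1,
    (genTop _).isOpen_univ, trivial, fun _ _ => ⟨trivial, trivial, one_ne_zero, (div_one _).symm⟩⟩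

theorem isMorphismAt_iff_regularAt {f : X → ℂ} : IsMorphismAt f x ↔ RegularAt f x := by
  refine ⟨fun hf => hf.regular _ (regularAt_id _), fun hf => .of_generated fun V g hb _ => ?_⟩
  obtain ⟨rfl, rfl⟩ := Prod.mk.inj (Set.mem_singleton_iff.1 hb)
  exact ⟨.of_forall fun _ => trivial, hf⟩

theorem RegularAt.sum {κ : Type*} (s : Finset κ) {f : κ → X → ℂ}
    (hf : ∀ i ∈ s, RegularAt (f i) x) : RegularAt (fun y => ∑ i ∈ s, f i y) x := by
  classical
  induction s using Finset.induction_on with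
  | empty => simpa only [Finset.sum_empty] using const 0 x
  | insert a s ha ih =>
    simp only [Finset.sum_insert ha]
    exact add (hf a (s.mem_insert_self a)) (ih fun i hi => hf i (Finset.mem_insert_of_mem hi))

theorem RegularAt.prod {κ : Type*} (s : Finset κ) {f : κ → X → ℂ}
    (hf : ∀ i ∈ s, RegularAt (f i) x) : RegularAt (fun y => ∏ i ∈ s, f i y) x := by
  classical
  induction s using Finset.induction_on with
  | empty => simpa only [Finset.prod_empty] using const 1 x
  | insert a s ha ih =>
    simp only [Finset.prod_insert ha]
    exact mul (hf a (s.mem_insert_self a)) (ih fun i hi => hf i (Finset.mem_insert_of_mem hi))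

end Germs

section Matrices

variable {X : Type*} [SpaceWithFunctions X] {x : X} {l m n o : Type*}

theorem isMorphismAt_matrix_iff {A : X → Matrix m n ℂ} :
    IsMorphismAt A x ↔ ∀ i j, RegularAt (fun y => A y i j) x :=
  (isMorphismAt_pi_iff (T := fun _ : m => n → ℂ)).trans <| forall_congr' fun _ =>
    (isMorphismAt_pi_iff (T := fun _ : n => ℂ)).trans <| forall_congr' fun _ =>
      isMorphismAt_iff_regularAt

namespace IsMorphismAt

theorem entry {A : X → Matrix m n ℂ} (hA : IsMorphismAt A x) (i : m) (j : n) :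
    RegularAt (fun y => A y i j) x :=
  isMorphismAt_matrix_iff.1 hA i j

theorem matrix_add {A B : X → Matrix m n ℂ} (hA : IsMorphismAt A x) (hB : IsMorphismAt B x) :
    IsMorphismAt (fun y => A y + B y) x :=
  isMorphismAt_matrix_iff.2 fun i j => SpaceWithFunctions.add (hA.entry i j) (hB.entry i j)

theorem matrix_neg {A : X → Matrix m n ℂ} (hA : IsMorphismAt A x) :
    IsMorphismAt (fun y => -A y) x :=
  isMorphismAt_matrix_iff.2 fun i j => by
    simpa only [Matrix.neg_apply, neg_one_mul] using
      SpaceWithFunctions.mul (SpaceWithFunctions.const (-1) x) (hA.entry i j)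

theorem matrix_sub {A B : X → Matrix m n ℂ} (hA : IsMorphismAt A x) (hB : IsMorphismAt B x) :
    IsMorphismAt (fun y => A y - B y) x := by
  simpa only [sub_eq_add_neg] using hA.matrix_add hB.matrix_neg

theorem matrix_mul [Fintype m] {A : X → Matrix l m ℂ} {B : X → Matrix m n ℂ}
    (hA : IsMorphismAt A x) (hB : IsMorphismAt B x) : IsMorphismAt (fun y => A y * B y) x := by
  refine isMorphismAt_matrix_iff.2 fun i j => ?_
  simp only [Matrix.mul_apply]
  exact RegularAt.sum _ fun k _ => SpaceWithFunctions.mul (hA.entry i k) (hB.entry k j)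

theorem matrix_transpose {A : X → Matrix m n ℂ} (hA : IsMorphismAt A x) :
    IsMorphismAt (fun y => (A y).transpose) x :=
  isMorphismAt_matrix_iff.2 fun i j => hA.entry j i

theorem submatrix {A : X → Matrix m n ℂ} (hA : IsMorphismAt A x) (r : l → m) (c : o → n) :
    IsMorphismAt (fun y => (A y).submatrix r c) x :=
  isMorphismAt_matrix_iff.2 fun i j => hA.entry (r i) (c j)

theorem fromRows {A : X → Matrix l n ℂ} {B : X → Matrix m n ℂ}
    (hA : IsMorphismAt A x) (hB : IsMorphismAt B x) :
    IsMorphismAt (fun y => Matrix.fromRows (A y) (B y)) x :=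
  isMorphismAt_matrix_iff.2 <| Sum.rec (fun i j => hA.entry i j) (fun i j => hB.entry i j)

theorem fromCols {A : X → Matrix m l ℂ} {B : X → Matrix m n ℂ}
    (hA : IsMorphismAt A x) (hB : IsMorphismAt B x) :
    IsMorphismAt (fun y => Matrix.fromCols (A y) (B y)) x :=
  isMorphismAt_matrix_iff.2 fun i => Sum.rec (fun j => hA.entry i j) (fun j => hB.entry i j)

theorem fromBlocks {A : X → Matrix n l ℂ} {B : X → Matrix n m ℂ} {C : X → Matrix o l ℂ}
    {D : X → Matrix o m ℂ} (hA : IsMorphismAt A x) (hB : IsMorphismAt B x)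
    (hC : IsMorphismAt C x) (hD : IsMorphismAt D x) :
    IsMorphismAt (fun y => Matrix.fromBlocks (A y) (B y) (C y) (D y)) x := by
  simpa only [Matrix.fromRows_fromCols_eq_fromBlocks] using
    (hA.fromCols hB).fromRows (hC.fromCols hD)

variable [Fintype n] [DecidableEq n]

theorem det {A : X → Matrix n n ℂ} (hA : IsMorphismAt A x) :
    RegularAt (fun y => (A y).det) x := by
  simp only [Matrix.det_apply']
  exact RegularAt.sum _ fun σ _ => SpaceWithFunctions.mul (SpaceWithFunctions.const _ x)
    (RegularAt.prod _ fun i _ => hA.entry _ _)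

theorem matrix_inv {A : X → Matrix n n ℂ} (hA : IsMorphismAt A x) (hdet : IsUnit (A x).det) :
    IsMorphismAt (fun y => (A y)⁻¹) x := by
  refine isMorphismAt_matrix_iff.2 fun i j => ?_
  simp only [Matrix.inv_def, Matrix.smul_apply, Ring.inverse_eq_inv', smul_eq_mul,
    Matrix.adjugate_apply]
  refine SpaceWithFunctions.mul (SpaceWithFunctions.inv hA.det hdet.ne_zero) (IsMorphismAt.det ?_)
  refine isMorphismAt_matrix_iff.2 fun a b => ?_
  obtain rfl | hne := eq_or_ne a j
  · simpa only [Matrix.updateRow_self] using SpaceWithFunctions.const _ x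
  · simpa only [Matrix.updateRow_ne hne] using hA.entry a b

theorem eventually_isUnit_det {A : X → Matrix n n ℂ} (hA : IsMorphismAt A x)
    (hdet : IsUnit (A x).det) : ∀ᶠ y in zariskiNhds x, IsUnit (A y).det := by
  simpa only [isUnit_iff_ne_zero] using hA.det.eventually_ne_zero hdet.ne_zero

end IsMorphismAt

end Matrices

end SpaceWithFunctions

/-! ### Split exact sequences of matrices -/

/-- Matrices of a short sequence `0 → K^a → K^m → K^n → 0` with maps `inc` and `proj`, together with
a section `sec` of `proj` and a retraction `ret` of `inc`.  Only the data are bundled, so that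
the deformations of a splitting are defined without side conditions; see `Splitting.IsExact`. -/
structure Splitting (K a m n : Type*) where
  inc : Matrix m a K
  proj : Matrix n m K
  sec : Matrix m n K
  ret : Matrix a m K

namespace Splitting

open Matrix

variable {K a m n o m' n' k k' : Type*}

/-- The matrices of `s` form a split exact sequence. -/
structure IsExact [CommRing K] [Fintype a] [Fintype m] [Fintype n] [DecidableEq a] [DecidableEq m]
    [DecidableEq n] (s : Splitting K a m n) : Prop where
  proj_mul_inc : s.proj * s.inc = 0
  proj_mul_sec : s.proj * s.sec = 1
  ret_mul_inc : s.ret * s.inc = 1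
  inc_mul_ret_add_sec_mul_proj : s.inc * s.ret + s.sec * s.proj = 1

/-- The dual sequence `0 → K^n → K^m → K^a → 0`. -/
def transpose (s : Splitting K a m n) : Splitting K n m a :=
  ⟨s.projᵀ, s.incᵀ, s.retᵀ, s.secᵀ⟩

/-- The sequence in which the middle space has been reindexed. -/
def reindex (e : m ≃ m') (s : Splitting K a m n) : Splitting K a m' n :=
  ⟨s.inc.submatrix e.symm id, s.proj.submatrix id e.symm, s.sec.submatrix e.symm id,
    s.ret.submatrix id e.symm⟩

section CommRing

variable [CommRing K] [Fintype m] [Fintype n] [DecidableEq n]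

/-- The sequence in which the projection has been replaced by `M`, with the same retraction and
the same image of the section; it is exact as long as `M * s.sec` is invertible. -/
noncomputable def deformProj (s : Splitting K a m n) (M : Matrix n m K) : Splitting K a m n where
  inc := s.inc - s.sec * (M * s.sec)⁻¹ * (M * s.inc)
  proj := M
  sec := s.sec * (M * s.sec)⁻¹
  ret := s.ret

/-- The sequence in which the inclusion has been replaced by `G`, with the same section and
the same kernel of the retraction; it is exact as long as `s.ret * G` is invertible. -/
noncomputable def deformInc [Fintype a] [DecidableEq a] (s : Splitting K a m n)
    (G : Matrix m a K) : Splitting K a m n :=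
  (s.transpose.deformProj Gᵀ).transpose

/-- The sequence `0 → K^m → K^m ⊕ K^n → K^n → 0` of the graph of `L`. -/
def graph [DecidableEq m] (L : Matrix n m K) : Splitting K m (m ⊕ n) n where
  inc := fromRows 1 L
  proj := fromCols (-L) 1
  sec := fromRows 0 1
  ret := fromCols 1 0

/-- The sum of `s` with the identity of `K^o`, sheared along `L`. -/
def shear [DecidableEq o] (s : Splitting K a m n) (L : Matrix o m K) :
    Splitting K a (m ⊕ o) (n ⊕ o) where
  inc := fromRows s.inc (L * s.inc)
  proj := fromBlocks s.proj 0 (-L) 1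
  sec := fromBlocks s.sec 0 (L * s.sec) 1
  ret := fromCols s.ret 0

end CommRing

namespace IsExact

section CommRing

variable [CommRing K] [Fintype a] [Fintype m] [Fintype n] [Fintype o] [Fintype m']
  [DecidableEq a] [DecidableEq m] [DecidableEq n] [DecidableEq o] [DecidableEq m']
  {s : Splitting K a m n}

theorem ret_mul_sec (h : s.IsExact) : s.ret * s.sec = 0 := by
  have hret := congrArg (fun B => s.ret * B * s.sec) h.inc_mul_ret_add_sec_mul_proj
  rwa [Matrix.mul_add, Matrix.add_mul, ← Matrix.mul_assoc s.ret s.inc, h.ret_mul_inc,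
    Matrix.one_mul, Matrix.mul_one, ← Matrix.mul_assoc s.ret, Matrix.mul_assoc (s.ret * s.sec),
    h.proj_mul_sec, Matrix.mul_one, add_eq_left] at hret

theorem transpose (h : s.IsExact) : s.transpose.IsExact where
  proj_mul_inc := by
    rw [Splitting.transpose, ← transpose_mul, h.proj_mul_inc, transpose_zero]
  proj_mul_sec := by
    rw [Splitting.transpose, ← transpose_mul, h.ret_mul_inc, transpose_one]
  ret_mul_inc := by
    rw [Splitting.transpose, ← transpose_mul, h.proj_mul_sec, transpose_one]
  inc_mul_ret_add_sec_mul_proj := by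
    rw [Splitting.transpose, ← transpose_mul, ← transpose_mul, ← transpose_add, add_comm,
      h.inc_mul_ret_add_sec_mul_proj, transpose_one]

theorem reindex (h : s.IsExact) (e : m ≃ m') : (s.reindex e).IsExact where
  proj_mul_inc := by simp [Splitting.reindex, h.proj_mul_inc]
  proj_mul_sec := by simp [Splitting.reindex, h.proj_mul_sec]
  ret_mul_inc := by simp [Splitting.reindex, h.ret_mul_inc]
  inc_mul_ret_add_sec_mul_proj := by
    rw [Splitting.reindex, ← submatrix_mul _ _ _ _ _ Function.bijective_id,
      ← submatrix_mul _ _ _ _ _ Function.bijective_id, ← Pi.add_apply, ← Pi.add_apply]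
    change (s.inc * s.ret + s.sec * s.proj).submatrix _ _ = 1
    rw [h.inc_mul_ret_add_sec_mul_proj, submatrix_one_equiv]

theorem deformProj (h : s.IsExact) {M : Matrix n m K} (hM : IsUnit (M * s.sec).det) :
    (s.deformProj M).IsExact where
  proj_mul_inc := by
    simp only [Splitting.deformProj, Matrix.mul_sub, ← Matrix.mul_assoc, mul_nonsing_inv _ hM,
      Matrix.one_mul, sub_self]
  proj_mul_sec := by rw [Splitting.deformProj, ← Matrix.mul_assoc, mul_nonsing_inv _ hM]
  ret_mul_inc := by
    simp only [Splitting.deformProj, Matrix.mul_sub, ← Matrix.mul_assoc, h.ret_mul_inc,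
      h.ret_mul_sec, Matrix.zero_mul, sub_zero]
  inc_mul_ret_add_sec_mul_proj := by
    have hM' : s.sec * (M * s.sec)⁻¹ * M * (1 - s.inc * s.ret) = s.sec * s.proj := by
      rw [← h.inc_mul_ret_add_sec_mul_proj, add_sub_cancel_left]
      simp only [Matrix.mul_assoc]
      rw [← Matrix.mul_assoc M, nonsing_inv_mul_cancel_left _ _ hM]
    rw [← h.inc_mul_ret_add_sec_mul_proj, ← hM']
    simp only [Splitting.deformProj, Matrix.mul_sub, Matrix.sub_mul, Matrix.mul_one,
      Matrix.mul_assoc]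
    abel

theorem deformInc (h : s.IsExact) {G : Matrix m a K} (hG : IsUnit (s.ret * G).det) :
    (s.deformInc G).IsExact :=
  (h.transpose.deformProj (by rwa [← det_transpose, transpose_mul] at hG)).transpose

omit [Fintype a] [DecidableEq a] in
theorem graph (L : Matrix n m K) : (graph L).IsExact where
  proj_mul_inc := by simp [Splitting.graph, fromCols_mul_fromRows]
  proj_mul_sec := by simp [Splitting.graph, fromCols_mul_fromRows]
  ret_mul_inc := by simp [Splitting.graph, fromCols_mul_fromRows]
  inc_mul_ret_add_sec_mul_proj := by
    rw [Splitting.graph, fromRows_mul_fromCols, fromRows_mul_fromCols, fromBlocks_add,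
      ← fromBlocks_one]
    simp

theorem shear (h : s.IsExact) (L : Matrix o m K) : (s.shear L).IsExact where
  proj_mul_inc := by
    simp [Splitting.shear, fromBlocks_mul_fromRows, h.proj_mul_inc]
  proj_mul_sec := by simp [Splitting.shear, fromBlocks_multiply, h.proj_mul_sec]
  ret_mul_inc := by simp [Splitting.shear, fromCols_mul_fromRows, h.ret_mul_inc]
  inc_mul_ret_add_sec_mul_proj := by
    have hL : L * s.inc * s.ret + L * s.sec * s.proj = L := by
      rw [Matrix.mul_assoc, Matrix.mul_assoc, ← Matrix.mul_add, h.inc_mul_ret_add_sec_mul_proj,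
        Matrix.mul_one]
    rw [Splitting.shear, fromRows_mul_fromCols, fromBlocks_multiply, fromBlocks_add,
      ← fromBlocks_one]
    congr 1
    · simp [h.inc_mul_ret_add_sec_mul_proj]
    · simp
    · simp [← add_assoc, hL]
    · simp

end CommRing

section Field

variable [Field K] [Fintype a] [Fintype m] [Fintype n] [DecidableEq a] [DecidableEq m]
  [DecidableEq n] {s : Splitting K a m n}

theorem ker_proj (h : s.IsExact) :
    LinearMap.ker s.proj.mulVecLin = LinearMap.range s.inc.mulVecLin := by
  refine le_antisymm ?_ ?_
  · refine fun x hx => ⟨s.ret *ᵥ x, ?_⟩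
    have hx' : s.proj *ᵥ x = 0 := hx
    simpa only [add_mulVec, ← mulVec_mulVec, hx', mulVec_zero, add_zero, one_mulVec,
      mulVecLin_apply] using
      congrArg (· *ᵥ x) h.inc_mul_ret_add_sec_mul_proj
  · rintro _ ⟨y, rfl⟩
    simp [h.proj_mul_inc]

theorem proj_surjective (h : s.IsExact) : Function.Surjective s.proj.mulVecLin := fun y =>
  ⟨s.sec *ᵥ y, by simp [h.proj_mul_sec]⟩

theorem finrank_range_inc (h : s.IsExact) :
    Module.finrank K (LinearMap.range s.inc.mulVecLin) = Fintype.card a := by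
  have hinj : Function.LeftInverse s.ret.mulVecLin s.inc.mulVecLin := fun x => by
    simp [h.ret_mul_inc]
  rw [LinearMap.finrank_range_of_inj hinj.injective, Module.finrank_fintype_fun_eq_card]

theorem comap_map (h : s.IsExact) {X : Submodule K (m → K)}
    (hX : LinearMap.range s.inc.mulVecLin ≤ X) :
    (X.map s.proj.mulVecLin).comap s.proj.mulVecLin = X := by
  rw [Submodule.comap_map_eq, h.ker_proj, sup_eq_left.2 hX]

theorem map_comap (h : s.IsExact) (Y : Submodule K (n → K)) :
    (Y.comap s.proj.mulVecLin).map s.proj.mulVecLin = Y :=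
  Submodule.map_comap_eq_of_surjective h.proj_surjective Y

theorem range_inc_le_comap (h : s.IsExact) (Y : Submodule K (n → K)) :
    LinearMap.range s.inc.mulVecLin ≤ Y.comap s.proj.mulVecLin :=
  h.ker_proj ▸ LinearMap.ker_le_comap _

theorem finrank_map (h : s.IsExact) {X : Submodule K (m → K)}
    (hX : LinearMap.range s.inc.mulVecLin ≤ X) :
    Fintype.card a + Module.finrank K (X.map s.proj.mulVecLin) = Module.finrank K X := by
  have hrank := LinearMap.finrank_range_add_finrank_ker (s.proj.mulVecLin.domRestrict X)
  rwa [LinearMap.range_domRestrict, LinearMap.ker_domRestrict, h.ker_proj,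
    (Submodule.comapSubtypeEquivOfLe hX).finrank_eq, h.finrank_range_inc, add_comm] at hrank

theorem finrank_comap (h : s.IsExact) (Y : Submodule K (n → K)) :
    Module.finrank K (Y.comap s.proj.mulVecLin) = Fintype.card a + Module.finrank K Y := by
  rw [← h.finrank_map (h.range_inc_le_comap Y), h.map_comap]

theorem comap_range_vecMulLinear (h : s.IsExact) [Fintype k] (B : Matrix k n K) :
    (LinearMap.range B.vecMulLinear).comap s.proj.mulVecLin =
      LinearMap.range (fromRows s.incᵀ (B * s.secᵀ)).vecMulLinear := by
  have hB : LinearMap.range B.vecMulLinear =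
      (LinearMap.range (B * s.secᵀ).vecMulLinear).map s.proj.mulVecLin := by
    simp only [← mulVecLin_transpose, ← LinearMap.range_comp, ← mulVecLin_mul, transpose_mul,
      transpose_transpose, ← Matrix.mul_assoc, h.proj_mul_sec, Matrix.one_mul]
  rw [hB, Submodule.comap_map_eq, h.ker_proj, sup_comm]
  simp only [range_vecMulLinear, range_mulVecLin, ← Submodule.span_union]
  congr 1
  ext x
  simp only [Set.mem_union, Set.mem_range, Sum.exists]
  rfl

end Field

end IsExact

end Splitting

namespace Splitting

open Matrix

variable {K a m n k l : Type*}

section CommRing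

variable [CommRing K] [Fintype a] [Fintype m] [Fintype k] [Fintype l]

/-- The projection of `t` maps the image of `A`, which contains the kernel of this projection, onto
the image of `A'`. -/
structure Reduces (t : Splitting K a m n) (A : Matrix m k K) (A' : Matrix n l K) : Prop where
  range_inc_le : LinearMap.range t.inc.mulVecLin ≤ LinearMap.range A.mulVecLin
  map_range : (LinearMap.range A.mulVecLin).map t.proj.mulVecLin = LinearMap.range A'.mulVecLin

theorem Reduces.of_mul_eq [DecidableEq l] {t : Splitting K a m n} {A : Matrix m k K}
    {A' : Matrix n l K} {B : Matrix k a K} {L : Matrix l k K} {L' : Matrix k l K}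
    (hinc : t.inc = A * B) (hproj : t.proj * A = A' * L) (hL : L * L' = 1) : t.Reduces A A' where
  range_inc_le := by
    rw [hinc, mulVecLin_mul]
    exact LinearMap.range_comp_le_range _ _
  map_range := by
    rw [← LinearMap.range_comp, ← mulVecLin_mul, hproj]
    refine le_antisymm ?_ ?_
    · rw [mulVecLin_mul]
      exact LinearMap.range_comp_le_range _ _
    · conv_lhs => rw [← Matrix.mul_one A', ← hL, ← Matrix.mul_assoc, mulVecLin_mul]
      exact LinearMap.range_comp_le_range _ _

theorem Reduces.reindex {m' k' : Type*} [Fintype m'] [Fintype k'] {t : Splitting K a m n}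
    {A : Matrix m k K} {A' : Matrix n l K} (h : t.Reduces A A') (e : m ≃ m') (f : k ≃ k') :
    (t.reindex e).Reduces (A.submatrix e.symm f.symm) A' where
  range_inc_le := by
    rintro _ ⟨x, rfl⟩
    obtain ⟨y, hy⟩ := h.range_inc_le ⟨x, rfl⟩
    refine ⟨y ∘ f.symm, funext fun i => ?_⟩
    rw [mulVecLin_apply, submatrix_mulVec_equiv, Equiv.symm_symm, Function.comp_assoc,
      Equiv.symm_comp_self, Function.comp_id]
    exact congrFun hy (e.symm i)
  map_range := by
    rw [← h.map_range, ← LinearMap.range_comp, ← LinearMap.range_comp, ← mulVecLin_mul,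
      ← mulVecLin_mul, Splitting.reindex, submatrix_mul_equiv]
    refine le_antisymm ?_ ?_
    · rintro _ ⟨x, rfl⟩
      exact ⟨x ∘ f, by simp [submatrix_mulVec_equiv, Function.comp_def]⟩
    · rintro _ ⟨x, rfl⟩
      exact ⟨x ∘ f.symm, by simp [submatrix_mulVec_equiv, Function.comp_def]⟩

variable {b o : Type*} [Fintype n] [DecidableEq m] [DecidableEq n] [Fintype b] [DecidableEq a]
  [Fintype o]

theorem graph_reduces [DecidableEq b] {s : Splitting K a m n} (hs : s.IsExact) (N : Matrix b m K)
    (D : Matrix b o K) (Z : Matrix m o K) :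
    (graph (N * s.sec)).Reduces (fromBlocks s.proj (s.proj * Z) N D)
      (fromCols (N * s.inc) (D - N * Z)) := by
  classical
  refine .of_mul_eq (B := fromRows s.sec 0) (L := fromBlocks s.ret (s.ret * Z) 0 1)
    (L' := fromBlocks s.inc (-Z) 0 1) ?_ ?_ ?_
  · simp [graph, fromBlocks_mul_fromRows, hs.proj_mul_sec]
  · have hN : N * s.inc * s.ret = N - N * s.sec * s.proj := by
      rw [eq_sub_iff_add_eq, Matrix.mul_assoc, Matrix.mul_assoc, ← Matrix.mul_add,
        hs.inc_mul_ret_add_sec_mul_proj, Matrix.mul_one]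
    rw [graph, fromCols_mul_fromBlocks, fromCols_mul_fromBlocks, ← Matrix.mul_assoc (N * s.inc), hN]
    congr 1
    · simp [sub_eq_neg_add]
    · simp only [Matrix.neg_mul, Matrix.one_mul, Matrix.sub_mul, Matrix.mul_one, Matrix.mul_assoc]
      abel
  · rw [fromBlocks_multiply, ← fromBlocks_one]
    simp [hs.ret_mul_inc]

theorem shear_reduces [DecidableEq o] {s : Splitting K a m n} (hs : s.IsExact) (P : Matrix m b K)
    (L : Matrix o m K) (D : Matrix o b K) :
    (s.shear L).Reduces (fromBlocks s.inc P (L * s.inc) D)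
      (fromRows (s.proj * P) (D - L * P)) := by
  classical
  refine .of_mul_eq (B := fromRows 1 0) (L := fromCols 0 1) (L' := fromRows 0 1) ?_ ?_ ?_
  · simp [shear, fromBlocks_mul_fromRows]
  · rw [shear, fromBlocks_multiply, fromRows_mul, mul_fromCols, mul_fromCols,
      fromRows_fromCols_eq_fromBlocks]
    simp [hs.proj_mul_inc, sub_eq_neg_add]
  · simp [fromCols_mul_fromRows]

end CommRing

section Filler

variable {a' m' n' : Type*} [CommRing K] [Fintype a'] [Fintype m'] [Fintype n]

/-- A diagonal filler `Z` of the square with sides `t.inc`, `s.proj`, `H` and `F`, that is,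
`s.proj * Z = F` and `Z * t.inc = H`; it exists when `s.proj * H = F * t.inc`. -/
def filler (s : Splitting K a m n) (t : Splitting K a' m' n') (F : Matrix n m' K)
    (H : Matrix m a' K) : Matrix m m' K :=
  s.sec * F + H * t.ret - s.sec * (F * t.inc) * t.ret

variable {s : Splitting K a m n} {t : Splitting K a' m' n'} {F : Matrix n m' K}
  {H : Matrix m a' K}

theorem IsExact.proj_mul_filler [Fintype a] [Fintype m] [DecidableEq a] [DecidableEq m]
    [DecidableEq n] (hs : s.IsExact) (h : s.proj * H = F * t.inc) :
    s.proj * filler s t F H = F := by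
  simp [filler, Matrix.mul_add, Matrix.mul_sub, ← Matrix.mul_assoc, hs.proj_mul_sec, h]

theorem IsExact.filler_mul_inc [Fintype n'] [DecidableEq a'] [DecidableEq m'] [DecidableEq n']
    (ht : t.IsExact) : filler s t F H * t.inc = H := by
  simp [filler, Matrix.add_mul, Matrix.sub_mul, Matrix.mul_assoc, ht.ret_mul_inc]

end Filler

section Field

variable [Field K] [Fintype a] [Fintype m] [Fintype k] [Fintype l] {t : Splitting K a m n}
  {A : Matrix m k K} {A' : Matrix n l K}

theorem Reduces.range_le_map (h : t.Reduces A A') {X : Submodule K (m → K)}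
    (hX : LinearMap.range A.mulVecLin ≤ X) :
    LinearMap.range A'.mulVecLin ≤ X.map t.proj.mulVecLin :=
  h.map_range ▸ Submodule.map_mono hX

theorem Reduces.range_le_comap (h : t.Reduces A A') {Y : Submodule K (n → K)}
    (hY : LinearMap.range A'.mulVecLin ≤ Y) :
    LinearMap.range A.mulVecLin ≤ Y.comap t.proj.mulVecLin :=
  Submodule.map_le_iff_le_comap.1 (h.map_range ▸ hY)

variable [Fintype n] [DecidableEq m] [DecidableEq n]

section

variable [DecidableEq a]

theorem Reduces.rank_eq (h : t.Reduces A A') (ht : t.IsExact) :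
    A.rank = Fintype.card a + A'.rank := by
  rw [Matrix.rank, Matrix.rank, ← h.map_range, ht.finrank_map h.range_inc_le]

theorem IsExact.card_eq (h : t.IsExact) :
    Fintype.card m = Fintype.card a + Fintype.card n := by
  have hrange := h.finrank_map le_top
  rwa [Submodule.map_top, LinearMap.range_eq_top.2 h.proj_surjective, finrank_top, finrank_top,
    Module.finrank_fintype_fun_eq_card, Module.finrank_fintype_fun_eq_card, eq_comm] at hrange

end

theorem exists_isExact_proj_eq {M : Matrix n m K} (hM : Function.Surjective M.mulVec) :
    ∃ b, ∃ s : Splitting K (Fin b) m n, s.IsExact ∧ s.proj = M := by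
  obtain ⟨S, hS⟩ := mulVec_surjective_iff_exists_right_inverse.1 hM
  let e := Module.finBasis K (LinearMap.ker M.mulVecLin)
  let inc : Matrix m _ K := Matrix.of fun i j => (e j : m → K) i
  have hker (x : m → K) (hx : M *ᵥ x = 0) : inc *ᵥ e.repr ⟨x, hx⟩ = x := by
    have hsum := congrArg (LinearMap.ker M.mulVecLin).subtype (e.sum_repr ⟨x, hx⟩)
    rw [map_sum] at hsum
    ext i
    simpa [inc, mulVec, dotProduct, mul_comm, -Module.Basis.sum_repr] using congrFun hsum i
  have hMinc : M * inc = 0 := by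
    ext i j
    exact congrFun (LinearMap.mem_ker.1 (e j).2) i
  have hinj : Function.Injective inc.mulVec := mulVec_injective_iff.2
    (e.linearIndependent.map' (Submodule.subtype _) (Submodule.ker_subtype _))
  have hcol (j : m) : M *ᵥ (1 - S * M).col j = 0 := by
    have hcomp : M * (1 - S * M) = 0 := by
      rw [Matrix.mul_sub, ← Matrix.mul_assoc, hS, Matrix.mul_one, Matrix.one_mul, sub_self]
    exact funext fun i => congrFun (congrFun hcomp i) j
  let ret : Matrix _ m K := Matrix.of fun i j => e.repr ⟨_, hcol j⟩ i
  have hret : inc * ret = 1 - S * M := by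
    ext i j
    exact congrFun (hker _ (hcol j)) i
  refine ⟨_, ⟨inc, M, S, ret⟩, ⟨hMinc, hS, ?_, by rw [hret, sub_add_cancel]⟩, rfl⟩
  refine Matrix.ext_of_mulVec_single fun j => hinj ?_
  rw [mulVec_mulVec, mulVec_mulVec, ← Matrix.mul_assoc, hret, Matrix.sub_mul, Matrix.mul_assoc S,
    hMinc, Matrix.mul_zero, sub_zero, Matrix.one_mul, Matrix.mul_one]

end Field

end Splitting

section MaximalMinors

open Matrix

variable {K m n k : Type*} [Field K] [Fintype n]

theorem exists_linearIndependent_rows [Finite m] {d : ℕ} (A : Matrix m n K) (hA : A.rank = d) :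
    ∃ (r : Fin d → m) (T : Matrix m (Fin d) K),
      LinearIndependent K (A.submatrix r id).row ∧ A = T * A.submatrix r id := by
  subst hA
  rw [rank_eq_finrank_span_row]
  obtain ⟨f, hf, hspan, hli⟩ := Submodule.exists_fun_fin_finrank_span_eq K (Set.range A.row)
  choose r hr using hf
  obtain rfl : A.row ∘ r = f := funext hr
  have hmem (i : m) : ∃ t : Fin _ → K, ∑ j, t j • A.row (r j) = A.row i :=
    (Submodule.mem_span_range_iff_exists_fun K).1
      (hspan.symm ▸ Submodule.subset_span (Set.mem_range_self i) : A.row i ∈ _)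
  choose T hT using hmem
  refine ⟨r, Matrix.of T, hli, Matrix.ext fun i k => ?_⟩
  simpa [mul_apply] using (congrFun (hT i) k).symm

theorem surjective_mulVec_of_linearIndependent_row [Finite m] {A : Matrix m n K}
    (hA : LinearIndependent K A.row) : Function.Surjective A.mulVec := by
  cases nonempty_fintype m
  refine (LinearMap.range_eq_top (f := A.mulVecLin)).1 (Submodule.eq_top_of_finrank_eq ?_)
  exact hA.rank_matrix.trans (Module.finrank_fintype_fun_eq_card K).symm

theorem surjective_mulVec_of_col_mem [Fintype k] {A : Matrix m n K} {B : Matrix m k K}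
    (hB : Function.Surjective B.mulVec)
    (h : ∀ j, B.col j ∈ LinearMap.range A.mulVecLin) : Function.Surjective A.mulVec := by
  refine (LinearMap.range_eq_top (f := A.mulVecLin)).1 (top_le_iff.1 ?_)
  rw [← (LinearMap.range_eq_top (f := B.mulVecLin)).2 hB, range_mulVecLin B, Submodule.span_le]
  exact Set.range_subset_iff.2 h

theorem exists_sum_equiv {a J : Type*} [Finite J] {c : a → J} (hc : Function.Injective c) :
    ∃ b, ∃ e : a ⊕ Fin b ≃ J, ∀ k, e (Sum.inl k) = c k := by
  classical
  obtain ⟨b, ⟨e⟩⟩ := Finite.exists_equiv_fin ↥(Set.range c)ᶜ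
  exact ⟨b, ((Equiv.ofInjective c hc).sumCongr e.symm).trans (Equiv.Set.sumCompl _),
    fun k => rfl⟩

end MaximalMinors

/-! ### Morphisms to Grassmannians -/

section FrameMatrices

open Matrix

variable {d : ℕ} {ι κ : Type*}

/-- The matrix whose rows are the vectors of the frame `b`. -/
def Frame.toMatrix (b : Frame d ι) : Matrix (Fin d) ι ℂ :=
  Matrix.of b.1

theorem Frame.range_vecMulLinear (b : Frame d ι) :
    LinearMap.range b.toMatrix.vecMulLinear = b.toGr.space :=
  _root_.range_vecMulLinear _

/-- The representative of the orbit of `b` under the general linear group for which the submatrix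
with columns `c` is the identity, provided that this submatrix of `b` is invertible. -/
noncomputable def Frame.normalize (c : Fin d → ι) (b : Frame d ι) : Matrix (Fin d) ι ℂ :=
  (b.toMatrix.submatrix id c)⁻¹ * b.toMatrix

theorem Frame.range_vecMulLinear_normalize {c : Fin d → ι} {b : Frame d ι}
    (hb : IsUnit (b.toMatrix.submatrix id c).det) :
    LinearMap.range (b.normalize c).vecMulLinear = b.toGr.space := by
  have hsurj : Function.Surjective (vecMulLinear (b.toMatrix.submatrix id c)⁻¹) := fun x =>
    ⟨x ᵥ* b.toMatrix.submatrix id c, by simp [vecMul_vecMul, mul_nonsing_inv _ hb]⟩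
  have hcomp : (b.normalize c).vecMulLinear =
      b.toMatrix.vecMulLinear ∘ₗ vecMulLinear (b.toMatrix.submatrix id c)⁻¹ :=
    LinearMap.ext fun x => (vecMul_vecMul x _ _).symm
  rw [hcomp, LinearMap.range_comp_of_range_eq_top _ (LinearMap.range_eq_top.2 hsurj),
    b.range_vecMulLinear]

theorem Frame.exists_toMatrix_eq_mul {b b' : Frame d ι} (h : b.toGr = b'.toGr) :
    ∃ T : Matrix (Fin d) (Fin d) ℂ, IsUnit T.det ∧ b'.toMatrix = T * b.toMatrix := by
  have hmem (i : Fin d) : b'.1 i ∈ LinearMap.range b.toMatrix.vecMulLinear := by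
    rw [b.range_vecMulLinear, h]
    exact Submodule.subset_span (Set.mem_range_self i)
  choose T hT using hmem
  refine ⟨Matrix.of T, ?_, Matrix.ext fun i => congrFun (hT i).symm⟩
  rw [← isUnit_iff_isUnit_det, ← linearIndependent_rows_iff_isUnit]
  have hb' : LinearIndependent ℂ (b.toMatrix.vecMulLinear ∘ T) := by
    rw [show _ ∘ T = b'.1 from funext hT]
    exact b'.2
  exact hb'.of_comp

theorem Frame.isUnit_det_submatrix_of_toGr_eq {b b' : Frame d ι} (h : b.toGr = b'.toGr)
    {c : Fin d → ι} (hb : IsUnit (b.toMatrix.submatrix id c).det) :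
    IsUnit (b'.toMatrix.submatrix id c).det := by
  obtain ⟨T, hT, hb'⟩ := exists_toMatrix_eq_mul h
  rw [hb', submatrix_mul _ _ _ _ _ Function.bijective_id, submatrix_id_id, det_mul]
  exact hT.mul hb

theorem Frame.normalize_eq_of_toGr_eq {b b' : Frame d ι} (h : b.toGr = b'.toGr) (c : Fin d → ι) :
    b'.normalize c = b.normalize c := by
  obtain ⟨T, hT, hb'⟩ := exists_toMatrix_eq_mul h
  rw [normalize, hb', submatrix_mul _ _ _ _ _ Function.bijective_id, submatrix_id_id,
    Matrix.mul_inv_rev, Matrix.mul_assoc, nonsing_inv_mul_cancel_left _ _ hT, normalize]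

theorem exists_isUnit_det_submatrix [Finite ι] {A : Matrix (Fin d) ι ℂ}
    (hA : LinearIndependent ℂ A.row) : ∃ c : Fin d → ι, IsUnit (A.submatrix id c).det := by
  cases nonempty_fintype ι
  have hrank : Aᵀ.rank = d := by rw [rank_transpose, hA.rank_matrix, Fintype.card_fin]
  obtain ⟨c, -, hc, -⟩ := exists_linearIndependent_rows Aᵀ hrank
  rw [linearIndependent_rows_iff_isUnit, isUnit_iff_isUnit_det, ← det_transpose] at hc
  exact ⟨c, hc⟩

theorem Gr.exists_toGr_eq [Finite ι] (X : Gr d ι) : ∃ b : Frame d ι, b.toGr = X := by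
  have b := Module.finBasisOfFinrankEq ℂ X.space X.finrank_eq
  refine ⟨⟨fun i => (b i : ι → ℂ), b.linearIndependent.map' X.space.subtype (by simp)⟩, ?_⟩
  ext1
  change Submodule.span ℂ (Set.range (X.space.subtype ∘ b)) = X.space
  rw [Set.range_comp, ← Submodule.map_span, b.span_eq, Submodule.map_subtype_top]

end FrameMatrices

namespace SpaceWithFunctions

open Filter Matrix

variable {Z : Type*} [SpaceWithFunctions Z] {z : Z} {d d' : ℕ} {ι κ a m n : Type*}

theorem isMorphismAt_toGr (b : Frame d ι) : IsMorphismAt Frame.toGr b where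
  tendsto _ hU := by
    obtain ⟨V, hV, hb, hVU⟩ := eventually_zariskiNhds_iff.1 hU
    exact eventually_zariskiNhds_iff.2 ⟨Frame.toGr ⁻¹' V, hV, hb, fun x hx => hVU _ hx⟩
  regular := fun _ ⟨_, _, hb, hg⟩ => hg b hb

theorem isMorphismAt_toMatrix (b : Frame d ι) : IsMorphismAt Frame.toMatrix b :=
  (isMorphismAt_id b).val

theorem Gr.exists_isMorphismAt_span [Finite ι] (X : Gr d ι) :
    ∃ g : Gr d ι → Matrix (Fin d) ι ℂ, IsMorphismAt g X ∧
      ∀ᶠ Y in zariskiNhds X, LinearMap.range (g Y).vecMulLinear = Y.space := by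
  choose b hb using Gr.exists_toGr_eq (d := d) (ι := ι)
  obtain ⟨c, hc⟩ := exists_isUnit_det_submatrix (A := (b X).toMatrix) (b X).2
  let V : Set (Gr d ι) := {Y | IsUnit ((b Y).toMatrix.submatrix id c).det}
  have hV {b' : Frame d ι} (h : b'.toGr ∈ V) : IsUnit (b'.toMatrix.submatrix id c).det :=
    Frame.isUnit_det_submatrix_of_toGr_eq (hb b'.toGr) h
  have hVopen : IsZariskiOpen V := by
    change IsZariskiOpen (Frame.toGr ⁻¹' V)
    refine isZariskiOpen_iff_eventually.2 fun b' hb' => ?_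
    filter_upwards [((isMorphismAt_toMatrix b').submatrix id c).eventually_isUnit_det (hV hb')]
      with y hy
    exact Frame.isUnit_det_submatrix_of_toGr_eq (hb y.toGr).symm hy
  refine ⟨fun Y => (b Y).normalize c, ?_, ?_⟩
  · refine isMorphismAt_matrix_iff.2 fun i j => ⟨V, hVopen, hc, fun b' hb' => ?_⟩
    simp only [Frame.normalize_eq_of_toGr_eq (hb (Frame.toGr _)).symm]
    exact ((((isMorphismAt_toMatrix b').submatrix id c).matrix_inv (hV hb')).matrix_mul
      (isMorphismAt_toMatrix b')).entry i j
  · filter_upwards [hVopen.eventually_mem hc] with Y hY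
    rw [Frame.range_vecMulLinear_normalize hY, hb]

theorem IsMorphismAt.exists_span [Finite ι] {f : Z → Gr d ι} (hf : IsMorphismAt f z) :
    ∃ g : Z → Matrix (Fin d) ι ℂ, IsMorphismAt g z ∧
      ∀ᶠ y in zariskiNhds z, LinearMap.range (g y).vecMulLinear = (f y).space := by
  obtain ⟨g, hg, hspan⟩ := Gr.exists_isMorphismAt_span (f z)
  exact ⟨_, hg.comp hf, hf.tendsto.eventually hspan⟩

theorem isMorphismAt_toGr_of_toMatrix {b : Z → Frame d ι}
    (hb : IsMorphismAt (fun y => (b y).toMatrix) z) : IsMorphismAt (fun y => (b y).toGr) z :=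
  (isMorphismAt_toGr (b z)).comp (.of_val hb)

theorem IsMorphismAt.of_span [Finite ι] [Fintype κ] {f : Z → Gr d ι} {g : Z → Matrix κ ι ℂ}
    (hg : IsMorphismAt g z)
    (hspan : ∀ᶠ y in zariskiNhds z, LinearMap.range (g y).vecMulLinear = (f y).space) :
    IsMorphismAt f z := by
  cases nonempty_fintype ι
  have hrank : (g z).rank = d := by
    rw [rank_eq_finrank_span_row, ← range_vecMulLinear, self_of_eventually hspan,
      (f z).finrank_eq]
  obtain ⟨r, -, hr, -⟩ := exists_linearIndependent_rows (g z) hrank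
  obtain ⟨c, hc⟩ := exists_isUnit_det_submatrix hr
  classical
  let b (y : Z) : Frame d ι :=
    if h : LinearIndependent ℂ ((g y).submatrix r id).row then ⟨_, h⟩ else ⟨_, hr⟩
  have hb : ∀ᶠ y in zariskiNhds z, (b y).toMatrix = (g y).submatrix r id := by
    filter_upwards [((hg.submatrix r id).submatrix id c).eventually_isUnit_det hc] with y hy
    have hli : LinearIndependent ℂ ((g y).submatrix r id).row :=
      .of_comp (LinearMap.funLeft ℂ ℂ c) (linearIndependent_rows_of_det_ne_zero hy.ne_zero)
    exact congrArg Frame.toMatrix (dif_pos hli)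
  refine (isMorphismAt_toGr_of_toMatrix
    ((hg.submatrix r id).congr_of_eventuallyEq (hb.mono fun _ => Eq.symm))).congr_of_eventuallyEq ?_
  filter_upwards [hb, hspan] with y hby hy
  ext1
  refine Submodule.eq_of_le_of_finrank_eq ?_ ((b y).toGr.finrank_eq.trans (f y).finrank_eq.symm)
  rw [← (b y).range_vecMulLinear, hby, ← hy, range_vecMulLinear, range_vecMulLinear]
  exact Submodule.span_mono (Set.range_comp_subset_range r (g y).row)

theorem IsMorphismAt.gr_map [Fintype m] [Finite n] {X : Z → Gr d m} {Y : Z → Gr d' n}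
    {A : Z → Matrix n m ℂ} (hX : IsMorphismAt X z) (hA : IsMorphismAt A z)
    (h : ∀ y, (Y y).space = (X y).space.map (A y).mulVecLin) : IsMorphismAt Y z := by
  obtain ⟨g, hg, hspan⟩ := hX.exists_span
  refine (hg.matrix_mul hA.matrix_transpose).of_span (hspan.mono fun y hy => ?_)
  rw [h, ← hy, ← mulVecLin_transpose, ← mulVecLin_transpose, transpose_mul, transpose_transpose,
    mulVecLin_mul, LinearMap.range_comp]

theorem IsMorphismAt.gr_comap [Fintype a] [Fintype m] [Fintype n] [DecidableEq a] [DecidableEq m]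
    [DecidableEq n] {X : Z → Gr d n} {Y : Z → Gr d' m} {s : Z → Splitting ℂ a m n}
    (hX : IsMorphismAt X z) (hinc : IsMorphismAt (fun y => (s y).inc) z)
    (hsec : IsMorphismAt (fun y => (s y).sec) z) (hs : ∀ y, (s y).IsExact)
    (h : ∀ y, (Y y).space = (X y).space.comap (s y).proj.mulVecLin) : IsMorphismAt Y z := by
  obtain ⟨g, hg, hspan⟩ := hX.exists_span
  refine (hinc.matrix_transpose.fromRows (hg.matrix_mul hsec.matrix_transpose)).of_span
    (hspan.mono fun y hy => ?_)
  rw [h, ← hy, (hs y).comap_range_vecMulLinear]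

end SpaceWithFunctions

/-! ### Slice charts -/

namespace QuiverVariety

open Sum Matrix

/-- The dimension vector with the first components of `w` replaced by `v₀`. -/
abbrev coreDim {I : Type*} (v₀ : I → ℕ) (w : FrameDim I) : FrameDim I :=
  ⟨v₀, w.dim'⟩

/-- A decomposition of the coordinates of every `W_i` into `v₀ i` core coordinates and `d i`
transversal coordinates. -/
structure CoordSplit {I : Type*} (v₀ d : I → ℕ) (w : FrameDim I) where
  equiv : ∀ i, Fin (v₀ i) ⊕ Fin (d i) ≃ Fin (w.dim i)

variable {I₀ I₁ : Type*} {Ω : I₁ → I₀ → Type*} {v₀ d : I₀ ⊕ I₁ → ℕ} {w : FrameDim (I₀ ⊕ I₁)}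

/-- The coordinates of the summand of `h` in the core part of the source of `A_α`. -/
abbrev sinkIncl (w : FrameDim (I₀ ⊕ I₁)) {β : I₁} {α : I₀} (h : Ω β α) (j : Fin (v₀ (inr β))) :
    SinkIndex Ω (coreDim v₀ w) α :=
  inr ⟨β, h, j⟩

/-- The coordinates of the summand of `h` in the core part of the target of `A_β`. -/
abbrev sourceIncl (w : FrameDim (I₀ ⊕ I₁)) {β : I₁} {α : I₀} (h : Ω β α) (i : Fin (v₀ (inl α))) :
    SourceIndex Ω (coreDim v₀ w) β :=
  inr ⟨α, h, i⟩

namespace CoordSplit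

variable (C : CoordSplit v₀ d w)

/-- The induced decomposition of the coordinates of the source of `A_α`; those of `W'_α` are core
coordinates. -/
def sinkEquiv (α : I₀) :
    SinkIndex Ω (coreDim v₀ w) α ⊕ (Σ (β : I₁) (_ : Ω β α), Fin (d (inr β))) ≃
      SinkIndex Ω w α where
  toFun := Sum.elim (Sum.map id fun x => ⟨x.1, x.2.1, C.equiv (inr x.1) (inl x.2.2)⟩)
    fun x => inr ⟨x.1, x.2.1, C.equiv (inr x.1) (inr x.2.2)⟩
  invFun := Sum.elim (fun j => inl (inl j)) fun x =>
    Sum.map (fun j => inr ⟨x.1, x.2.1, j⟩) (fun k => ⟨x.1, x.2.1, k⟩)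
      ((C.equiv (inr x.1)).symm x.2.2)
  left_inv := by rintro ((j | ⟨β, h, j⟩) | ⟨β, h, k⟩) <;> simp
  right_inv := by
    rintro (j | ⟨β, h, j⟩)
    · simp
    · obtain ⟨k | k, rfl⟩ := (C.equiv (inr β)).surjective j <;> simp

/-- The induced decomposition of the coordinates of the target of `A_β`; those of `W'_β` are core
coordinates. -/
def sourceEquiv (β : I₁) :
    SourceIndex Ω (coreDim v₀ w) β ⊕ (Σ (α : I₀) (_ : Ω β α), Fin (d (inl α))) ≃
      SourceIndex Ω w β where
  toFun := Sum.elim (Sum.map id fun x => ⟨x.1, x.2.1, C.equiv (inl x.1) (inl x.2.2)⟩)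
    fun x => inr ⟨x.1, x.2.1, C.equiv (inl x.1) (inr x.2.2)⟩
  invFun := Sum.elim (fun j => inl (inl j)) fun x =>
    Sum.map (fun j => inr ⟨x.1, x.2.1, j⟩) (fun k => ⟨x.1, x.2.1, k⟩)
      ((C.equiv (inl x.1)).symm x.2.2)
  left_inv := by rintro ((j | ⟨α, h, j⟩) | ⟨α, h, k⟩) <;> simp
  right_inv := by
    rintro (j | ⟨α, h, j⟩)
    · simp
    · obtain ⟨k | k, rfl⟩ := (C.equiv (inl α)).surjective j <;> simp

section Blocks

variable (q : RepSpace Ω w)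

/-- The block `M` of `A_α` between core coordinates. -/
def sinkCore (α : I₀) : Matrix (Fin (v₀ (inl α))) (SinkIndex Ω (coreDim v₀ w) α) ℂ :=
  (sinkMatrix q α).submatrix (C.equiv (inl α) ∘ inl) (C.sinkEquiv α ∘ inl)

/-- The block `N` of `A_α` from core to transversal coordinates. -/
def sinkLower (α : I₀) : Matrix (Fin (d (inl α))) (SinkIndex Ω (coreDim v₀ w) α) ℂ :=
  (sinkMatrix q α).submatrix (C.equiv (inl α) ∘ inr) (C.sinkEquiv α ∘ inl)

/-- The block `M` of `A_β` between core coordinates. -/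
def sourceCore (β : I₁) : Matrix (SourceIndex Ω (coreDim v₀ w) β) (Fin (v₀ (inr β))) ℂ :=
  (sourceMatrix q β).submatrix (C.sourceEquiv β ∘ inl) (C.equiv (inr β) ∘ inl)

/-- The block `P` of `A_β` from transversal to core coordinates. -/
def sourceRight (β : I₁) : Matrix (SourceIndex Ω (coreDim v₀ w) β) (Fin (d (inr β))) ℂ :=
  (sourceMatrix q β).submatrix (C.sourceEquiv β ∘ inl) (C.equiv (inr β) ∘ inr)

/-- The block `D` of `y_h` between transversal coordinates. -/
def arrowCorner {β : I₁} {α : I₀} (h : Ω β α) :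
    Matrix (Fin (d (inl α))) (Fin (d (inr β))) ℂ :=
  (q.2.2 β α h).submatrix (C.equiv (inl α) ∘ inr) (C.equiv (inr β) ∘ inr)

/-- The block of `A_α` from transversal to core coordinates. -/
def sinkRight (α : I₀) :
    Matrix (Fin (v₀ (inl α))) (Σ (β : I₁) (_ : Ω β α), Fin (d (inr β))) ℂ :=
  Matrix.of fun i x => C.sourceRight q x.1 (sourceIncl w x.2.1 i) x.2.2

/-- The block of `A_α` between transversal coordinates. -/
def sinkCorner (α : I₀) :
    Matrix (Fin (d (inl α))) (Σ (β : I₁) (_ : Ω β α), Fin (d (inr β))) ℂ :=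
  Matrix.of fun i x => C.arrowCorner q x.2.1 i x.2.2

/-- The block of `A_β` from core to transversal coordinates. -/
def sourceLower (β : I₁) :
    Matrix (Σ (α : I₀) (_ : Ω β α), Fin (d (inl α))) (Fin (v₀ (inr β))) ℂ :=
  Matrix.of fun x j => C.sinkLower q x.1 x.2.2 (sinkIncl w x.2.1 j)

/-- The block of `A_β` between transversal coordinates. -/
def sourceCorner (β : I₁) :
    Matrix (Σ (α : I₀) (_ : Ω β α), Fin (d (inl α))) (Fin (d (inr β))) ℂ :=
  Matrix.of fun x k => C.arrowCorner q x.2.1 x.2.2 k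

theorem sinkMatrix_eq (α : I₀) : sinkMatrix q α =
    (fromBlocks (C.sinkCore q α) (C.sinkRight q α) (C.sinkLower q α)
      (C.sinkCorner q α)).submatrix (C.equiv (inl α)).symm (C.sinkEquiv α).symm := by
  ext i j
  obtain ⟨i, rfl⟩ := (C.equiv (inl α)).surjective i
  obtain ⟨j, rfl⟩ := (C.sinkEquiv α).surjective j
  rw [submatrix_apply, Equiv.symm_apply_apply, Equiv.symm_apply_apply]
  rcases i with i | i <;> rcases j with j | ⟨β, h, j⟩ <;> rfl

theorem sourceMatrix_eq (β : I₁) : sourceMatrix q β =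
    (fromBlocks (C.sourceCore q β) (C.sourceRight q β) (C.sourceLower q β)
      (C.sourceCorner q β)).submatrix (C.sourceEquiv β).symm (C.equiv (inr β)).symm := by
  ext i j
  obtain ⟨i, rfl⟩ := (C.sourceEquiv β).surjective i
  obtain ⟨j, rfl⟩ := (C.equiv (inr β)).surjective j
  rw [submatrix_apply, Equiv.symm_apply_apply, Equiv.symm_apply_apply]
  rcases i with i | ⟨α, h, i⟩ <;> rcases j with j | j <;> rfl

variable {q} in
theorem ext_blocks {q' : RepSpace Ω w} (hM : ∀ α, C.sinkCore q α = C.sinkCore q' α)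
    (hM' : ∀ β, C.sourceCore q β = C.sourceCore q' β)
    (hN : ∀ α, C.sinkLower q α = C.sinkLower q' α)
    (hP : ∀ β, C.sourceRight q β = C.sourceRight q' β)
    (hD : ∀ (β : I₁) (α : I₀) (h : Ω β α), C.arrowCorner q h = C.arrowCorner q' h) : q = q' := by
  have hsink (α : I₀) : sinkMatrix q α = sinkMatrix q' α := by
    simp only [C.sinkMatrix_eq, sinkRight, sinkCorner, hM, hN, hP, hD]
  have hsource (β : I₁) : sourceMatrix q β = sourceMatrix q' β := by
    simp only [C.sourceMatrix_eq, sourceLower, sourceCorner, hM', hN, hP, hD]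
  refine Prod.ext (funext fun α => ?_) (Prod.ext (funext fun β => ?_) (funext fun β => funext
    fun α => funext fun h => ?_))
  · exact Matrix.ext fun i j => congrFun (congrFun (hsink α) i) (inl j)
  · exact Matrix.ext fun i j => congrFun (congrFun (hsource β) (inl i)) j
  · exact Matrix.ext fun i j => congrFun (congrFun (hsink α) i) (inr ⟨β, h, j⟩)

section Assemble

variable (N : ∀ α : I₀, Matrix (Fin (d (inl α))) (SinkIndex Ω (coreDim v₀ w) α) ℂ)
  (P : ∀ β : I₁, Matrix (SourceIndex Ω (coreDim v₀ w) β) (Fin (d (inr β))) ℂ)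
  (D : ∀ (β : I₁) (α : I₀), Ω β α → Matrix (Fin (d (inl α))) (Fin (d (inr β))) ℂ)

/-- The representation with the core blocks of `q` and the given other blocks. -/
def assemble : RepSpace Ω w :=
  (fun α => (fromRows ((C.sinkCore q α).submatrix id inl) ((N α).submatrix id inl)).submatrix
    (C.equiv (inl α)).symm id,
   fun β => (fromCols ((C.sourceCore q β).submatrix inl id) ((P β).submatrix inl id)).submatrix
    id (C.equiv (inr β)).symm,
   fun β α h => (fromBlocks ((C.sinkCore q α).submatrix id (sinkIncl w h))
    ((P β).submatrix (sourceIncl w h) id) ((N α).submatrix id (sinkIncl w h))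
    (D β α h)).submatrix (C.equiv (inl α)).symm (C.equiv (inr β)).symm)

@[simp]
theorem sinkCore_assemble (α : I₀) : C.sinkCore (C.assemble q N P D) α = C.sinkCore q α := by
  ext i (j | ⟨β, h, j⟩) <;> simp [sinkCore, sinkMatrix, assemble, sinkEquiv]

@[simp]
theorem sinkLower_assemble (α : I₀) : C.sinkLower (C.assemble q N P D) α = N α := by
  ext i (j | ⟨β, h, j⟩) <;> simp [sinkLower, sinkMatrix, assemble, sinkEquiv]

@[simp]
theorem sourceCore_assemble (β : I₁) :
    C.sourceCore (C.assemble q N P D) β = C.sourceCore q β := by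
  ext (i | ⟨α, h, i⟩) j <;>
    simp [sourceCore, sinkCore, sinkMatrix, sourceMatrix, assemble, sourceEquiv, sinkEquiv]

@[simp]
theorem sourceRight_assemble (β : I₁) : C.sourceRight (C.assemble q N P D) β = P β := by
  ext (i | ⟨α, h, i⟩) j <;> simp [sourceRight, sourceMatrix, assemble, sourceEquiv]

@[simp]
theorem arrowCorner_assemble {β : I₁} {α : I₀} (h : Ω β α) :
    C.arrowCorner (C.assemble q N P D) h = D β α h := by
  ext i j
  simp [arrowCorner, assemble]

end Assemble

end Blocks

end CoordSplit

end QuiverVariety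

namespace QuiverVariety

open Sum Matrix

/-- The data of a slice chart: coordinates in which the sequences with projections `M_α` and
inclusions `M_β` split at the centre. The components `wP.dim'` are the dimensions of the kernel
of `M_α` and of the cokernel of `M_β`. -/
structure SliceChart {I₀ I₁ : Type*} (Ω : I₁ → I₀ → Type*) [Fintype I₀] [Fintype I₁]
    [∀ β α, Fintype (Ω β α)] [DecidableEq I₀] [DecidableEq I₁] [∀ β α, DecidableEq (Ω β α)]
    (v₀ : I₀ ⊕ I₁ → ℕ) (w wP : FrameDim (I₀ ⊕ I₁)) extends
    CoordSplit v₀ wP.dim w where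
  sink : ∀ α : I₀, Splitting ℂ (Fin (wP.dim' (inl α))) (SinkIndex Ω (coreDim v₀ w) α)
    (Fin (v₀ (inl α)))
  sink_isExact : ∀ α, (sink α).IsExact
  source : ∀ β : I₁, Splitting ℂ (Fin (v₀ (inr β))) (SourceIndex Ω (coreDim v₀ w) β)
    (Fin (wP.dim' (inr β)))
  source_isExact : ∀ β, (source β).IsExact

namespace SliceChart

variable {I₀ I₁ : Type*} {Ω : I₁ → I₀ → Type*} [Fintype I₀] [Fintype I₁]
  [∀ β α, Fintype (Ω β α)] [DecidableEq I₀] [DecidableEq I₁] [∀ β α, DecidableEq (Ω β α)]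
  {v₀ : I₀ ⊕ I₁ → ℕ} {w wP : FrameDim (I₀ ⊕ I₁)}
  (C : SliceChart Ω v₀ w wP)

/-- The representations with core blocks transversal to the splittings of the chart. -/
def domain : Set (RepSpace Ω w) :=
  {q | (∀ α, IsUnit (C.sinkCore q α * (C.sink α).sec).det) ∧
    ∀ β, IsUnit ((C.source β).ret * C.sourceCore q β).det}

section Definitions

variable (q : RepSpace Ω w)

/-- The splitting of `M_α`. -/
noncomputable def sinkSplit (α : I₀) :
    Splitting ℂ (Fin (wP.dim' (inl α))) (SinkIndex Ω (coreDim v₀ w) α) (Fin (v₀ (inl α))) :=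
  (C.sink α).deformProj (C.sinkCore q α)

/-- The splitting of `M_β`. -/
noncomputable def sourceSplit (β : I₁) :
    Splitting ℂ (Fin (v₀ (inr β))) (SourceIndex Ω (coreDim v₀ w) β) (Fin (wP.dim' (inr β))) :=
  (C.source β).deformInc (C.sourceCore q β)

/-- A map `Z_h` from the target of `M_β` to the source of `M_α` for which `M_α Z_h` is the
projection to the summand of `h` and `Z_h M_β` is the inclusion of the summand of `h`. -/
noncomputable def arrowFiller {β : I₁} {α : I₀} (h : Ω β α) :
    Matrix (SinkIndex Ω (coreDim v₀ w) α) (SourceIndex Ω (coreDim v₀ w) β) ℂ :=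
  Splitting.filler (C.sinkSplit q α) (C.sourceSplit q β)
    ((1 : Matrix _ _ ℂ).submatrix (sourceIncl w h) id)
    ((1 : Matrix _ _ ℂ).submatrix id (sinkIncl w h))

/-- The transversal coordinates of `q`: the restriction of `N` to `ker M_α`, the composition of `P`
with the projection to `coker M_β`, and a Schur complement of `D`. -/
noncomputable def perp : RepSpace Ω wP :=
  (fun α => C.sinkLower q α * (C.sinkSplit q α).inc,
   fun β => (C.sourceSplit q β).proj * C.sourceRight q β,
   fun β α h => C.arrowCorner q h - C.sinkLower q α * C.arrowFiller q h * C.sourceRight q β)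

/-- The block `N` of `glue q r`. -/
noncomputable def glueLower (r : RepSpace Ω wP) (α : I₀) :
    Matrix (Fin (wP.dim (inl α))) (SinkIndex Ω (coreDim v₀ w) α) ℂ :=
  C.sinkLower q α * (C.sinkSplit q α).sec * (C.sinkSplit q α).proj + r.1 α * (C.sinkSplit q α).ret

/-- The block `P` of `glue q r`. -/
noncomputable def glueRight (r : RepSpace Ω wP) (β : I₁) :
    Matrix (SourceIndex Ω (coreDim v₀ w) β) (Fin (wP.dim (inr β))) ℂ :=
  (C.sourceSplit q β).inc * ((C.sourceSplit q β).ret * C.sourceRight q β) +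
    (C.sourceSplit q β).sec * r.2.1 β

/-- The representation `q` with its transversal coordinates replaced by `r`. -/
noncomputable def glue (r : RepSpace Ω wP) : RepSpace Ω w :=
  C.assemble q (C.glueLower q r) (C.glueRight q r) fun β α h =>
    r.2.2 β α h + C.glueLower q r α * C.arrowFiller q h * C.glueRight q r β

end Definitions

section Glue

variable (q : RepSpace Ω w) (r r' : RepSpace Ω wP)

@[simp]
theorem sinkCore_glue (α : I₀) : C.sinkCore (C.glue q r) α = C.sinkCore q α := by simp [glue]

@[simp]
theorem sourceCore_glue (β : I₁) : C.sourceCore (C.glue q r) β = C.sourceCore q β := by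
  simp [glue]

@[simp]
theorem sinkLower_glue (α : I₀) : C.sinkLower (C.glue q r) α = C.glueLower q r α := by
  simp [glue]

@[simp]
theorem sourceRight_glue (β : I₁) : C.sourceRight (C.glue q r) β = C.glueRight q r β := by
  simp [glue]

@[simp]
theorem arrowCorner_glue {β : I₁} {α : I₀} (h : Ω β α) : C.arrowCorner (C.glue q r) h =
    r.2.2 β α h + C.glueLower q r α * C.arrowFiller q h * C.glueRight q r β := by
  simp [glue]

@[simp]
theorem sinkSplit_glue (α : I₀) : C.sinkSplit (C.glue q r) α = C.sinkSplit q α := by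
  simp [sinkSplit]

@[simp]
theorem sourceSplit_glue (β : I₁) : C.sourceSplit (C.glue q r) β = C.sourceSplit q β := by
  simp [sourceSplit]

@[simp]
theorem arrowFiller_glue {β : I₁} {α : I₀} (h : Ω β α) :
    C.arrowFiller (C.glue q r) h = C.arrowFiller q h := by
  simp [arrowFiller]

theorem glue_mem_domain : C.glue q r ∈ C.domain ↔ q ∈ C.domain := by simp [domain]

end Glue

section Lens

variable {C} {q : RepSpace Ω w} (hq : q ∈ C.domain)

include hq in
theorem sinkSplit_isExact (α : I₀) : (C.sinkSplit q α).IsExact :=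
  (C.sink_isExact α).deformProj (hq.1 α)

include hq in
theorem sourceSplit_isExact (β : I₁) : (C.sourceSplit q β).IsExact :=
  (C.source_isExact β).deformInc (hq.2 β)

include hq

theorem glueLower_mul_inc (r : RepSpace Ω wP) (α : I₀) :
    C.glueLower q r α * (C.sinkSplit q α).inc = r.1 α := by
  have hs := sinkSplit_isExact hq α
  rw [glueLower, Matrix.add_mul, Matrix.mul_assoc, Matrix.mul_assoc (r.1 α), hs.proj_mul_inc,
    hs.ret_mul_inc, Matrix.mul_zero, Matrix.mul_one, zero_add]

theorem glueLower_mul_sec (r : RepSpace Ω wP) (α : I₀) :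
    C.glueLower q r α * (C.sinkSplit q α).sec = C.sinkLower q α * (C.sinkSplit q α).sec := by
  have hs := sinkSplit_isExact hq α
  rw [glueLower, Matrix.add_mul, Matrix.mul_assoc, Matrix.mul_assoc (r.1 α), hs.proj_mul_sec,
    hs.ret_mul_sec, Matrix.mul_zero, Matrix.mul_one, add_zero]

theorem proj_mul_glueRight (r : RepSpace Ω wP) (β : I₁) :
    (C.sourceSplit q β).proj * C.glueRight q r β = r.2.1 β := by
  have hs := sourceSplit_isExact hq β
  rw [glueRight, Matrix.mul_add, ← Matrix.mul_assoc, ← Matrix.mul_assoc _ _ (r.2.1 β),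
    hs.proj_mul_inc, hs.proj_mul_sec, Matrix.zero_mul, Matrix.one_mul, zero_add]

theorem ret_mul_glueRight (r : RepSpace Ω wP) (β : I₁) :
    (C.sourceSplit q β).ret * C.glueRight q r β = (C.sourceSplit q β).ret * C.sourceRight q β := by
  have hs := sourceSplit_isExact hq β
  rw [glueRight, Matrix.mul_add, ← Matrix.mul_assoc, ← Matrix.mul_assoc _ _ (r.2.1 β),
    hs.ret_mul_inc, hs.ret_mul_sec, Matrix.zero_mul, Matrix.one_mul, add_zero]

theorem perp_glue (r : RepSpace Ω wP) : C.perp (C.glue q r) = r := by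
  simp [perp, glueLower_mul_inc hq, proj_mul_glueRight hq]

theorem glue_glue (r r' : RepSpace Ω wP) : C.glue (C.glue q r) r' = C.glue q r' := by
  have hlower (α : I₀) : C.glueLower (C.glue q r) r' α = C.glueLower q r' α := by
    rw [glueLower, sinkLower_glue, sinkSplit_glue, glueLower_mul_sec hq, glueLower]
  have hright (β : I₁) : C.glueRight (C.glue q r) r' β = C.glueRight q r' β := by
    rw [glueRight, sourceRight_glue, sourceSplit_glue, ret_mul_glueRight hq, glueRight]
  exact C.ext_blocks (by simp) (by simp) (by simp [hlower]) (by simp [hright])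
    (by simp [hlower, hright])

theorem glue_perp : C.glue q (C.perp q) = q := by
  have hlower (α : I₀) : C.glueLower q (C.perp q) α = C.sinkLower q α := by
    have hs := sinkSplit_isExact hq α
    rw [glueLower, perp, Matrix.mul_assoc, Matrix.mul_assoc, ← Matrix.mul_add, add_comm,
      hs.inc_mul_ret_add_sec_mul_proj, Matrix.mul_one]
  have hright (β : I₁) : C.glueRight q (C.perp q) β = C.sourceRight q β := by
    have hs := sourceSplit_isExact hq β
    rw [glueRight, perp, ← Matrix.mul_assoc, ← Matrix.mul_assoc, ← Matrix.add_mul,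
      hs.inc_mul_ret_add_sec_mul_proj, Matrix.one_mul]
  refine C.ext_blocks (by simp) (by simp) (by simp [hlower]) (by simp [hright]) fun β α h => ?_
  rw [arrowCorner_glue, hlower, hright, perp, sub_add_cancel]

end Lens

end SliceChart

end QuiverVariety

namespace QuiverVariety

open Sum Matrix

namespace SliceChart

variable {I₀ I₁ : Type*} {Ω : I₁ → I₀ → Type*} [Fintype I₀] [Fintype I₁]
  [∀ β α, Fintype (Ω β α)] [DecidableEq I₀] [DecidableEq I₁] [∀ β α, DecidableEq (Ω β α)]
  {v₀ : I₀ ⊕ I₁ → ℕ} {w wP : FrameDim (I₀ ⊕ I₁)}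
  (C : SliceChart Ω v₀ w wP)

section Definitions

variable (q : RepSpace Ω w)

/-- The products `N_α Z_h`, stacked vertically. -/
noncomputable def lowerFiller (β : I₁) :
    Matrix (Σ (α : I₀) (_ : Ω β α), Fin (wP.dim (inl α))) (SourceIndex Ω (coreDim v₀ w) β) ℂ :=
  Matrix.of fun x j => (C.sinkLower q x.1 * C.arrowFiller q x.2.1) x.2.2 j

/-- The products `Z_h P_β`, side by side. -/
noncomputable def fillerRight (α : I₀) :
    Matrix (SinkIndex Ω (coreDim v₀ w) α) (Σ (β : I₁) (_ : Ω β α), Fin (wP.dim (inr β))) ℂ :=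
  Matrix.of fun i x => (C.arrowFiller q x.2.1 * C.sourceRight q x.1) i x.2.2

/-- The splitting with projection `W_α → W_α^⊥`, along the graph of `N S` for the section `S`
of `M_α`. -/
noncomputable def sinkReduction (α : I₀) :
    Splitting ℂ (Fin (v₀ (inl α))) (Fin (w.dim (inl α))) (Fin (wP.dim (inl α))) :=
  (Splitting.graph (C.sinkLower q α * (C.sinkSplit q α).sec)).reindex (C.equiv (inl α))

/-- The splitting with projection from the target of `A_β` to its analogue for `w^⊥`. -/
noncomputable def sourceReduction (β : I₁) :
    Splitting ℂ (Fin (v₀ (inr β))) (SourceIndex Ω w β) (SourceIndex Ω wP β) :=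
  ((C.sourceSplit q β).shear (C.lowerFiller q β)).reindex (C.sourceEquiv β)

theorem sinkReduction_isExact (α : I₀) : (C.sinkReduction q α).IsExact :=
  (Splitting.IsExact.graph _).reindex _

theorem sinkMatrix_perp (α : I₀) : sinkMatrix (C.perp q) α =
    fromCols (C.sinkLower q α * (C.sinkSplit q α).inc)
      (C.sinkCorner q α - C.sinkLower q α * C.fillerRight q α) := by
  ext i (j | ⟨β, h, k⟩)
  · rfl
  · change C.arrowCorner q h i k - (C.sinkLower q α * C.arrowFiller q h * C.sourceRight q β) i k = _
    rw [Matrix.mul_assoc]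
    rfl

theorem sourceMatrix_perp (β : I₁) : sourceMatrix (C.perp q) β =
    fromRows ((C.sourceSplit q β).proj * C.sourceRight q β)
      (C.sourceCorner q β - C.lowerFiller q β * C.sourceRight q β) := by
  ext (j | ⟨α, h, k⟩) i <;> rfl

end Definitions

variable {C} {q : RepSpace Ω w} (hq : q ∈ C.domain)

include hq

theorem sourceReduction_isExact (β : I₁) : (C.sourceReduction q β).IsExact :=
  ((sourceSplit_isExact hq β).shear _).reindex _

theorem sinkCore_mul_arrowFiller {β : I₁} {α : I₀} (h : Ω β α) :
    C.sinkCore q α * C.arrowFiller q h = (1 : Matrix _ _ ℂ).submatrix (sourceIncl w h) id :=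
  (sinkSplit_isExact hq α).proj_mul_filler
    ((congrArg (·.submatrix id (sinkIncl w h)) (Matrix.mul_one (C.sinkCore q α))).trans
      (congrArg (·.submatrix (sourceIncl w h) id) (Matrix.one_mul (C.sourceCore q β))).symm)

theorem arrowFiller_mul_sourceCore {β : I₁} {α : I₀} (h : Ω β α) :
    C.arrowFiller q h * C.sourceCore q β = (1 : Matrix _ _ ℂ).submatrix id (sinkIncl w h) :=
  (sourceSplit_isExact hq β).filler_mul_inc

theorem sinkCore_mul_fillerRight (α : I₀) :
    C.sinkCore q α * C.fillerRight q α = C.sinkRight q α := by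
  ext i ⟨β, h, k⟩
  have hZ : C.sinkCore q α * (C.arrowFiller q h * C.sourceRight q β) =
      (C.sourceRight q β).submatrix (sourceIncl w h) id := by
    rw [← Matrix.mul_assoc, sinkCore_mul_arrowFiller hq]
    exact congrArg (·.submatrix (sourceIncl w h) id) (Matrix.one_mul (C.sourceRight q β))
  exact congrFun (congrFun hZ i) k

theorem lowerFiller_mul_sourceCore (β : I₁) :
    C.lowerFiller q β * C.sourceCore q β = C.sourceLower q β := by
  ext ⟨α, h, i⟩ j
  have hZ : C.sinkLower q α * C.arrowFiller q h * C.sourceCore q β =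
      (C.sinkLower q α).submatrix id (sinkIncl w h) := by
    rw [Matrix.mul_assoc, arrowFiller_mul_sourceCore hq]
    exact congrArg (·.submatrix id (sinkIncl w h)) (Matrix.mul_one (C.sinkLower q α))
  exact congrFun (congrFun hZ i) j

theorem sinkReduction_reduces (α : I₀) :
    (C.sinkReduction q α).Reduces (sinkMatrix q α) (sinkMatrix (C.perp q) α) := by
  rw [C.sinkMatrix_eq, sinkMatrix_perp, ← sinkCore_mul_fillerRight hq]
  exact (Splitting.graph_reduces (sinkSplit_isExact hq α) _ _ _).reindex _ _

theorem sourceReduction_reduces (β : I₁) :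
    (C.sourceReduction q β).Reduces (sourceMatrix q β) (sourceMatrix (C.perp q) β) := by
  rw [C.sourceMatrix_eq, sourceMatrix_perp, ← lowerFiller_mul_sourceCore hq]
  exact (Splitting.shear_reduces (sourceSplit_isExact hq β) _ _ _).reindex _ _

theorem rankA_eq (i : I₀ ⊕ I₁) : rankA q i = v₀ i + rankA (C.perp q) i := by
  rcases i with α | β
  · simpa [rankA] using (sinkReduction_reduces hq α).rank_eq (C.sinkReduction_isExact q α)
  · simpa [rankA] using (sourceReduction_reduces hq β).rank_eq (sourceReduction_isExact hq β)

/-- On the component of `h`, the two reductions differ by `N K T Z`, where `N K` is a block of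
the slice coordinate of `A_α`. -/
theorem sinkReduction_sub_sourceReduction_mem {β : I₁} {α : I₀} (h : Ω β α)
    (ξ : SourceIndex Ω w β → ℂ) :
    ((C.sinkReduction q α).proj *ᵥ fun k => ξ (inr ⟨α, h, k⟩)) -
        (fun k => ((C.sourceReduction q β).proj *ᵥ ξ) (inr ⟨α, h, k⟩)) ∈
      LinearMap.range (sinkMatrix (C.perp q) α).mulVecLin := by
  obtain ⟨x, y, rfl⟩ : ∃ x y, ξ = Sum.elim x y ∘ (C.sourceEquiv β).symm :=
    ⟨_, _, by rw [Sum.elim_comp_inl_inr (ξ ∘ C.sourceEquiv β), Function.comp_assoc,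
      Equiv.self_comp_symm, Function.comp_id]⟩
  have hsplit : (fun k => (Sum.elim x y ∘ (C.sourceEquiv β).symm) (inr ⟨α, h, k⟩)) =
      Sum.elim (C.sinkCore q α *ᵥ (C.arrowFiller q h *ᵥ x)) (fun i => y ⟨α, h, i⟩) ∘
        (C.equiv (inl α)).symm := by
    rw [mulVec_mulVec, sinkCore_mul_arrowFiller hq]
    ext k
    obtain ⟨k | k, rfl⟩ := (C.equiv (inl α)).surjective k <;>
      simp [CoordSplit.sourceEquiv, mulVec, dotProduct, one_apply]
  have hsink : (C.sinkReduction q α).proj *ᵥ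
      (fun k => (Sum.elim x y ∘ (C.sourceEquiv β).symm) (inr ⟨α, h, k⟩)) =
      (fun i => y ⟨α, h, i⟩) - (C.sinkLower q α * (C.sinkSplit q α).sec * C.sinkCore q α) *ᵥ
        (C.arrowFiller q h *ᵥ x) := by
    rw [hsplit, sinkReduction, Splitting.reindex, Splitting.graph, submatrix_mulVec_equiv]
    simp [Function.comp_assoc, neg_mulVec, sub_eq_neg_add, Matrix.mul_assoc]
  have hsource : (fun k => ((C.sourceReduction q β).proj *ᵥ
      (Sum.elim x y ∘ (C.sourceEquiv β).symm)) (inr ⟨α, h, k⟩)) =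
      (fun i => y ⟨α, h, i⟩) - C.sinkLower q α *ᵥ (C.arrowFiller q h *ᵥ x) := by
    rw [sourceReduction, Splitting.reindex, Splitting.shear, submatrix_mulVec_equiv, mulVec_mulVec]
    ext i
    simp only [Equiv.symm_symm, Function.comp_assoc, Equiv.symm_comp_self, CompTriple.comp_eq,
      fromBlocks_mulVec, Sum.elim_comp_inl, Sum.elim_comp_inr, zero_mulVec, add_zero, neg_mulVec,
      one_mulVec, ← sub_eq_neg_add, Function.comp_apply, id_eq, Sum.elim_inr, Pi.sub_apply,
      sub_right_inj]
    rfl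
  have hlower : C.sinkLower q α - C.sinkLower q α * (C.sinkSplit q α).sec * C.sinkCore q α =
      C.sinkLower q α * (C.sinkSplit q α).inc * (C.sinkSplit q α).ret := by
    rw [sub_eq_iff_eq_add, Matrix.mul_assoc, Matrix.mul_assoc, ← Matrix.mul_add]
    exact ((congrArg _ (sinkSplit_isExact hq α).inc_mul_ret_add_sec_mul_proj).trans
      (Matrix.mul_one _)).symm
  refine ⟨Sum.elim ((C.sinkSplit q α).ret *ᵥ (C.arrowFiller q h *ᵥ x)) 0, ?_⟩
  rw [hsink, hsource, sub_sub_sub_cancel_left, ← sub_mulVec, hlower, mulVecLin_apply,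
    sinkMatrix_perp, fromCols_mulVec_sumElim, mulVec_zero, add_zero, mulVec_mulVec]

end SliceChart

end QuiverVariety

/-! ### Regularity of the slice coordinates -/

namespace Splitting

open Matrix SpaceWithFunctions

variable {X : Type*} [SpaceWithFunctions X] {x : X} {a m n o m' : Type*}

/-- The matrices of a family of splittings, parametrized by a variety, are morphisms at `x`. -/
structure IsRegularAt (s : X → Splitting ℂ a m n) (x : X) : Prop where
  inc : IsMorphismAt (fun y => (s y).inc) x
  proj : IsMorphismAt (fun y => (s y).proj) x
  sec : IsMorphismAt (fun y => (s y).sec) x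
  ret : IsMorphismAt (fun y => (s y).ret) x

namespace IsRegularAt

variable {s : X → Splitting ℂ a m n}

theorem transpose (hs : IsRegularAt s x) : IsRegularAt (fun y => (s y).transpose) x :=
  ⟨hs.proj.matrix_transpose, hs.inc.matrix_transpose, hs.ret.matrix_transpose,
    hs.sec.matrix_transpose⟩

theorem reindex (hs : IsRegularAt s x) (e : m ≃ m') : IsRegularAt (fun y => (s y).reindex e) x :=
  ⟨hs.inc.submatrix _ _, hs.proj.submatrix _ _, hs.sec.submatrix _ _, hs.ret.submatrix _ _⟩

theorem deformProj [Fintype m] [Fintype n] [DecidableEq n] {M : X → Matrix n m ℂ}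
    (s : Splitting ℂ a m n) (hM : IsMorphismAt M x) (hdet : IsUnit (M x * s.sec).det) :
    IsRegularAt (fun y => s.deformProj (M y)) x :=
  have hinv := (hM.matrix_mul (.const s.sec)).matrix_inv hdet
  have hsec := (IsMorphismAt.const s.sec).matrix_mul hinv
  ⟨(IsMorphismAt.const s.inc).matrix_sub
    (hsec.matrix_mul (hM.matrix_mul (.const s.inc))), hM, hsec, .const s.ret⟩

theorem deformInc [Fintype a] [Fintype m] [DecidableEq a] {G : X → Matrix m a ℂ}
    (s : Splitting ℂ a m n) (hG : IsMorphismAt G x) (hdet : IsUnit (s.ret * G x).det) :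
    IsRegularAt (fun y => s.deformInc (G y)) x := by
  refine (IsRegularAt.deformProj s.transpose hG.matrix_transpose ?_).transpose
  rwa [Splitting.transpose, ← transpose_mul, det_transpose]

theorem graph [DecidableEq m] [DecidableEq n] {L : X → Matrix n m ℂ} (hL : IsMorphismAt L x) :
    IsRegularAt (fun y => Splitting.graph (L y)) x :=
  ⟨(IsMorphismAt.const 1).fromRows hL, hL.matrix_neg.fromCols (.const 1),
    .const _, .const _⟩

theorem shear [Fintype m] [DecidableEq o] {L : X → Matrix o m ℂ}
    (hs : IsRegularAt s x) (hL : IsMorphismAt L x) : IsRegularAt (fun y => (s y).shear (L y)) x :=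
  ⟨hs.inc.fromRows (hL.matrix_mul hs.inc),
    hs.proj.fromBlocks (.const 0) hL.matrix_neg (.const 1),
    hs.sec.fromBlocks (.const 0) (hL.matrix_mul hs.sec) (.const 1),
    hs.ret.fromCols (.const 0)⟩

theorem filler {a' n' : Type*} [Fintype n] [Fintype m'] [Fintype a']
    {t : X → Splitting ℂ a' m' n'} {F : X → Matrix n m' ℂ} {H : X → Matrix m a' ℂ}
    (hs : IsRegularAt s x) (ht : IsRegularAt t x) (hF : IsMorphismAt F x) (hH : IsMorphismAt H x) :
    IsMorphismAt (fun y => (s y).filler (t y) (F y) (H y)) x :=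
  ((hs.sec.matrix_mul hF).matrix_add (hH.matrix_mul ht.ret)).matrix_sub
    ((hs.sec.matrix_mul (hF.matrix_mul ht.inc)).matrix_mul ht.ret)

end IsRegularAt

end Splitting

namespace QuiverVariety

open Sum Matrix SpaceWithFunctions

section RepSpace

variable {X : Type*} [SpaceWithFunctions X] {x : X} {I₀ I₁ : Type*} {Ω : I₁ → I₀ → Type*}
  {w : FrameDim (I₀ ⊕ I₁)} {Q : X → RepSpace Ω w}

theorem isMorphismAt_repSpace_iff : IsMorphismAt Q x ↔
    (∀ α, IsMorphismAt (fun y => (Q y).1 α) x) ∧ (∀ β, IsMorphismAt (fun y => (Q y).2.1 β) x) ∧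
      ∀ β α h, IsMorphismAt (fun y => (Q y).2.2 β α h) x := by
  simp only [← isMorphismAt_pi_iff]
  exact ⟨fun hQ => ⟨hQ.fst, hQ.snd.fst, hQ.snd.snd⟩, fun hQ => hQ.1.prodMk (hQ.2.1.prodMk hQ.2.2)⟩

variable (hQ : IsMorphismAt Q x)

include hQ

theorem isMorphismAt_sinkMatrix (α : I₀) : IsMorphismAt (fun y => sinkMatrix (Q y) α) x :=
  isMorphismAt_matrix_iff.2 fun i => Sum.rec
    (fun j => ((isMorphismAt_repSpace_iff.1 hQ).1 α).entry i j)
    fun j => ((isMorphismAt_repSpace_iff.1 hQ).2.2 j.1 α j.2.1).entry i j.2.2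

theorem isMorphismAt_sourceMatrix (β : I₁) : IsMorphismAt (fun y => sourceMatrix (Q y) β) x :=
  isMorphismAt_matrix_iff.2 <| Sum.rec
    (fun i j => ((isMorphismAt_repSpace_iff.1 hQ).2.1 β).entry i j)
    fun i j => ((isMorphismAt_repSpace_iff.1 hQ).2.2 β i.1 i.2.1).entry i.2.2 j

end RepSpace

namespace CoordSplit

variable {X : Type*} [SpaceWithFunctions X] {x : X} {I₀ I₁ : Type*} {Ω : I₁ → I₀ → Type*}
  {v₀ d : I₀ ⊕ I₁ → ℕ} {w : FrameDim (I₀ ⊕ I₁)} (C : CoordSplit v₀ d w)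
  {Q : X → RepSpace Ω w} (hQ : IsMorphismAt Q x)

include hQ

theorem isMorphismAt_sinkCore (α : I₀) : IsMorphismAt (fun y => C.sinkCore (Q y) α) x :=
  (isMorphismAt_sinkMatrix hQ α).submatrix _ _

theorem isMorphismAt_sinkLower (α : I₀) : IsMorphismAt (fun y => C.sinkLower (Q y) α) x :=
  (isMorphismAt_sinkMatrix hQ α).submatrix _ _

theorem isMorphismAt_sourceCore (β : I₁) : IsMorphismAt (fun y => C.sourceCore (Q y) β) x :=
  (isMorphismAt_sourceMatrix hQ β).submatrix _ _

theorem isMorphismAt_sourceRight (β : I₁) : IsMorphismAt (fun y => C.sourceRight (Q y) β) x :=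
  (isMorphismAt_sourceMatrix hQ β).submatrix _ _

theorem isMorphismAt_arrowCorner {β : I₁} {α : I₀} (h : Ω β α) :
    IsMorphismAt (fun y => C.arrowCorner (Q y) h) x :=
  ((isMorphismAt_repSpace_iff.1 hQ).2.2 β α h).submatrix _ _

theorem isMorphismAt_assemble
    {N : X → ∀ α : I₀, Matrix (Fin (d (inl α))) (SinkIndex Ω (coreDim v₀ w) α) ℂ}
    {P : X → ∀ β : I₁, Matrix (SourceIndex Ω (coreDim v₀ w) β) (Fin (d (inr β))) ℂ}
    {D : X → ∀ (β : I₁) (α : I₀), Ω β α → Matrix (Fin (d (inl α))) (Fin (d (inr β))) ℂ}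
    (hN : ∀ α, IsMorphismAt (fun y => N y α) x) (hP : ∀ β, IsMorphismAt (fun y => P y β) x)
    (hD : ∀ β α h, IsMorphismAt (fun y => D y β α h) x) :
    IsMorphismAt (fun y => C.assemble (Q y) (N y) (P y) (D y)) x := by
  have hM := C.isMorphismAt_sinkCore hQ
  refine isMorphismAt_repSpace_iff.2 ⟨fun α => ?_, fun β => ?_, fun β α h => ?_⟩
  · exact (((hM α).submatrix _ _).fromRows ((hN α).submatrix _ _)).submatrix _ _
  · exact (((C.isMorphismAt_sourceCore hQ β).submatrix _ _).fromCols
      ((hP β).submatrix _ _)).submatrix _ _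
  · exact (((hM α).submatrix _ _).fromBlocks ((hP β).submatrix _ _) ((hN α).submatrix _ _)
      (hD β α h)).submatrix _ _

end CoordSplit

namespace SliceChart

variable {X : Type*} [SpaceWithFunctions X] {x : X} {I₀ I₁ : Type*} {Ω : I₁ → I₀ → Type*}
  [Fintype I₀] [Fintype I₁] [∀ β α, Fintype (Ω β α)] [DecidableEq I₀] [DecidableEq I₁]
  [∀ β α, DecidableEq (Ω β α)] {v₀ : I₀ ⊕ I₁ → ℕ} {w wP : FrameDim (I₀ ⊕ I₁)}
  (C : SliceChart Ω v₀ w wP)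

theorem isZariskiOpen_domain (S : Set (RepSpace Ω w)) :
    IsZariskiOpen {q : S | (q : RepSpace Ω w) ∈ S ∩ C.domain} := by
  refine isZariskiOpen_iff_eventually.2 fun q hq => ?_
  have hval : IsMorphismAt (fun q : S => (q : RepSpace Ω w)) q := (isMorphismAt_id q).val
  filter_upwards [Filter.eventually_all.2 fun α => ((C.isMorphismAt_sinkCore hval α).matrix_mul
      (.const (C.sink α).sec)).eventually_isUnit_det (hq.2.1 α),
    Filter.eventually_all.2 fun β => ((IsMorphismAt.const (C.source β).ret).matrix_mul
      (C.isMorphismAt_sourceCore hval β)).eventually_isUnit_det (hq.2.2 β)] with y hsink hsource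
  exact ⟨y.2, hsink, hsource⟩

variable {C} {Q : X → RepSpace Ω w} (hQ : IsMorphismAt Q x) (hx : Q x ∈ C.domain)

include hQ hx

theorem isRegularAt_sinkSplit (α : I₀) :
    Splitting.IsRegularAt (fun y => C.sinkSplit (Q y) α) x :=
  .deformProj _ (C.isMorphismAt_sinkCore hQ α) (hx.1 α)

theorem isRegularAt_sourceSplit (β : I₁) :
    Splitting.IsRegularAt (fun y => C.sourceSplit (Q y) β) x :=
  .deformInc _ (C.isMorphismAt_sourceCore hQ β) (hx.2 β)

theorem isMorphismAt_arrowFiller {β : I₁} {α : I₀} (h : Ω β α) :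
    IsMorphismAt (fun y => C.arrowFiller (Q y) h) x :=
  (isRegularAt_sinkSplit hQ hx α).filler (isRegularAt_sourceSplit hQ hx β) (.const _)
    (.const _)

theorem isMorphismAt_perp : IsMorphismAt (fun y => C.perp (Q y)) x := by
  have hN := C.isMorphismAt_sinkLower hQ
  have hP := C.isMorphismAt_sourceRight hQ
  refine isMorphismAt_repSpace_iff.2 ⟨fun α => ?_, fun β => ?_, fun β α h => ?_⟩
  · exact (hN α).matrix_mul (isRegularAt_sinkSplit hQ hx α).inc
  · exact (isRegularAt_sourceSplit hQ hx β).proj.matrix_mul (hP β)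
  · exact (C.isMorphismAt_arrowCorner hQ h).matrix_sub
      (((hN α).matrix_mul (isMorphismAt_arrowFiller hQ hx h)).matrix_mul (hP β))

theorem isMorphismAt_glue {R : X → RepSpace Ω wP} (hR : IsMorphismAt R x) :
    IsMorphismAt (fun y => C.glue (Q y) (R y)) x := by
  obtain ⟨hR₀, hR₁, hRΩ⟩ := isMorphismAt_repSpace_iff.1 hR
  have hlower (α : I₀) : IsMorphismAt (fun y => C.glueLower (Q y) (R y) α) x :=
    have hs := isRegularAt_sinkSplit hQ hx α
    (((C.isMorphismAt_sinkLower hQ α).matrix_mul hs.sec).matrix_mul hs.proj).matrix_add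
      ((hR₀ α).matrix_mul hs.ret)
  have hright (β : I₁) : IsMorphismAt (fun y => C.glueRight (Q y) (R y) β) x :=
    have hs := isRegularAt_sourceSplit hQ hx β
    (hs.inc.matrix_mul (hs.ret.matrix_mul (C.isMorphismAt_sourceRight hQ β))).matrix_add
      (hs.sec.matrix_mul (hR₁ β))
  exact C.isMorphismAt_assemble hQ hlower hright fun β α h => (hRΩ β α h).matrix_add
    (((hlower α).matrix_mul (isMorphismAt_arrowFiller hQ hx h)).matrix_mul (hright β))

theorem isRegularAt_sinkReduction (α : I₀) :
    Splitting.IsRegularAt (fun y => C.sinkReduction (Q y) α) x :=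
  (Splitting.IsRegularAt.graph ((C.isMorphismAt_sinkLower hQ α).matrix_mul
    (isRegularAt_sinkSplit hQ hx α).sec)).reindex _

theorem isRegularAt_sourceReduction (β : I₁) :
    Splitting.IsRegularAt (fun y => C.sourceReduction (Q y) β) x :=
  have hfiller : IsMorphismAt (fun y => C.lowerFiller (Q y) β) x :=
    isMorphismAt_matrix_iff.2 fun i => ((C.isMorphismAt_sinkLower hQ i.1).matrix_mul
      (isMorphismAt_arrowFiller hQ hx i.2.1)).entry i.2.2
  ((isRegularAt_sourceSplit hQ hx β).shear hfiller).reindex _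

end SliceChart

end QuiverVariety

/-! ### Product decompositions -/

namespace QuiverVariety

open Sum Matrix SpaceWithFunctions

section Rank

theorem rank_eq_zero_iff {m n : Type*} [Fintype n] {A : Matrix m n ℂ} :
    A.rank = 0 ↔ A = 0 := by
  classical
  rw [Matrix.rank, Submodule.finrank_eq_zero, LinearMap.range_eq_bot, ← Matrix.toLin'_apply',
    LinearEquiv.map_eq_zero_iff]

variable {I₀ I₁ : Type*} {Ω : I₁ → I₀ → Type*} {w : FrameDim (I₀ ⊕ I₁)}

theorem eq_zero_iff_sinkMatrix_sourceMatrix {q : RepSpace Ω w} :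
    q = 0 ↔ (∀ α, sinkMatrix q α = 0) ∧ ∀ β, sourceMatrix q β = 0 := by
  refine ⟨?_, fun ⟨hsink, hsource⟩ => ?_⟩
  · rintro rfl
    exact ⟨fun α => by ext i (j | ⟨β, h, j⟩) <;> rfl, fun β => by ext (i | ⟨α, h, i⟩) j <;> rfl⟩
  · refine Prod.ext (funext fun α => ?_) (Prod.ext (funext fun β => ?_) (funext fun β => funext
      fun α => funext fun h => ?_))
    · exact Matrix.ext fun i j => congrFun (congrFun (hsink α) i) (inl j)
    · exact Matrix.ext fun i j => congrFun (congrFun (hsource β) (inl i)) j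
    · exact Matrix.ext fun i j => congrFun (congrFun (hsink α) i) (inr ⟨β, h, j⟩)

theorem sinkMatrix_smul (c : ℂ) (q : RepSpace Ω w) (α : I₀) :
    sinkMatrix (c • q) α = c • sinkMatrix q α := by
  ext i (j | ⟨β, h, j⟩) <;> rfl

theorem sourceMatrix_smul (c : ℂ) (q : RepSpace Ω w) (β : I₁) :
    sourceMatrix (c • q) β = c • sourceMatrix q β := by
  ext (i | ⟨α, h, i⟩) j <;> rfl

variable [Fintype I₁] [∀ β α, Fintype (Ω β α)] {q : RepSpace Ω w}

theorem rankA_eq_zero_iff : (∀ i, rankA q i = 0) ↔ q = 0 := by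
  simp only [Sum.forall, eq_zero_iff_sinkMatrix_sourceMatrix, rankA, rank_eq_zero_iff]

theorem rankA_smul {c : ℂ} (hc : c ≠ 0) (q : RepSpace Ω w) : rankA (c • q) = rankA q := by
  ext (α | β)
  · rw [rankA, sinkMatrix_smul]
    exact rank_smul_of_mem_nonZeroDivisors _ (mem_nonZeroDivisors_of_ne_zero hc)
  · rw [rankA, sourceMatrix_smul]
    exact rank_smul_of_mem_nonZeroDivisors _ (mem_nonZeroDivisors_of_ne_zero hc)

end Rank

namespace SliceChart

variable {I₀ I₁ : Type*} {Ω : I₁ → I₀ → Type*} [Fintype I₀] [Fintype I₁]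
  [∀ β α, Fintype (Ω β α)] [DecidableEq I₀] [DecidableEq I₁] [∀ β α, DecidableEq (Ω β α)]
  {v v₀ : I₀ ⊕ I₁ → ℕ} {w wP : FrameDim (I₀ ⊕ I₁)} (C : SliceChart Ω v₀ w wP)
  {q : RepSpace Ω w} {r : RepSpace Ω wP}

theorem smul_mem_domain {c : ℂ} (hc : c ≠ 0) (hq : q ∈ C.domain) : c • q ∈ C.domain := by
  have hsink (α : I₀) : C.sinkCore (c • q) α = c • C.sinkCore q α := by
    rw [CoordSplit.sinkCore, sinkMatrix_smul]; rfl
  have hsource (β : I₁) : C.sourceCore (c • q) β = c • C.sourceCore q β := by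
    rw [CoordSplit.sourceCore, sourceMatrix_smul]; rfl
  have hunit (n : ℕ) : IsUnit (c ^ n) := (IsUnit.mk0 c hc).pow n
  refine ⟨fun α => ?_, fun β => ?_⟩
  · rw [hsink, Matrix.smul_mul, det_smul]
    exact (hunit _).mul (hq.1 α)
  · rw [hsource, Matrix.mul_smul, det_smul]
    exact (hunit _).mul (hq.2 β)

variable {C}

section Domain

variable (hq : q ∈ C.domain)

include hq

theorem rankA_glue (r : RepSpace Ω wP) (i : I₀ ⊕ I₁) :
    rankA (C.glue q r) i = v₀ i + rankA r i := by
  rw [rankA_eq ((C.glue_mem_domain q r).2 hq), perp_glue hq]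

theorem mem_stratum_iff : q ∈ Stratum Ω v₀ w ↔ C.perp q = 0 := by
  rw [← rankA_eq_zero_iff]
  exact forall_congr' fun i => by rw [rankA_eq hq, add_eq_left]

theorem perp_mem_E (h : q ∈ E Ω v w) : C.perp q ∈ E Ω (v - v₀) wP := fun i =>
  Nat.le_sub_of_add_le' ((rankA_eq hq i).symm.le.trans (h i))

theorem perp_mem_stratum (h : q ∈ Stratum Ω v w) : C.perp q ∈ Stratum Ω (v - v₀) wP := fun i =>
  (Nat.sub_eq_of_eq_add' ((h i).symm.trans (rankA_eq hq i))).symm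

theorem glue_mem_E (hv : v₀ ≤ v) (hr : r ∈ E Ω (v - v₀) wP) : C.glue q r ∈ E Ω v w := fun i =>
  (rankA_glue hq r i).le.trans
    ((Nat.add_le_add_left (hr i) _).trans (Nat.add_sub_cancel' (hv i)).le)

theorem glue_mem_stratum (hv : v₀ ≤ v) (hr : r ∈ Stratum Ω (v - v₀) wP) :
    C.glue q r ∈ Stratum Ω v w := fun i =>
  (rankA_glue hq r i).trans (hr i ▸ Nat.add_sub_cancel' (hv i))

theorem glue_zero_mem_stratum : C.glue q 0 ∈ Stratum Ω v₀ w :=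
  (mem_stratum_iff ((C.glue_mem_domain q 0).2 hq)).2 (perp_glue hq 0)

end Domain

variable (C)

/-- The open subset `E_{v,w} ∩ domain` of `E_{v,w}`. -/
abbrev openE (v : I₀ ⊕ I₁ → ℕ) : Set (RepSpace Ω w) := E Ω v w ∩ C.domain

/-- The open subset of the stratum `E°_{v₀,w}` in the domain of the chart. -/
abbrev openStratum : Set (RepSpace Ω w) := Stratum Ω v₀ w ∩ C.domain

variable {C}

/-- The representation in the stratum with the same core as `q`. -/
noncomputable def base (hq : q ∈ C.domain) : C.openStratum :=
  ⟨C.glue q 0, glue_zero_mem_stratum hq, (C.glue_mem_domain q 0).2 hq⟩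

theorem isMorphismAt_base {X : Type*} [SpaceWithFunctions X] {x : X} {Q : X → RepSpace Ω w}
    (hQ : IsMorphismAt Q x) (hdom : ∀ y, Q y ∈ C.domain) :
    IsMorphismAt (fun y => base (hdom y)) x :=
  .of_val (isMorphismAt_glue hQ (hdom x) (.const 0))

theorem glue_base (hq : q ∈ C.domain) (r : RepSpace Ω wP) : C.glue (base hq) r = C.glue q r :=
  glue_glue hq 0 r

theorem base_eq_self {q : RepSpace Ω w} (hq : q ∈ C.openStratum) : base hq.2 = ⟨q, hq⟩ :=
  Subtype.ext <| by
    have := glue_perp hq.2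
    rwa [(mem_stratum_iff hq.2).1 hq.1] at this

theorem base_glue (q : C.openStratum) (r : RepSpace Ω wP)
    (h : C.glue q r ∈ C.domain) : base h = q :=
  (Subtype.ext (glue_glue q.2.2 r 0)).trans (base_eq_self q.2)

/-- The product decomposition of `openE v`. -/
noncomputable def isoE (C : SliceChart Ω v₀ w wP) (hv : v₀ ≤ v) :
    Iso (C.openE v) (C.openStratum × E Ω (v - v₀) wP) where
  toFun q := (base q.2.2, ⟨C.perp q, perp_mem_E q.2.2 q.2.1⟩)
  invFun r := ⟨C.glue r.1 r.2, glue_mem_E r.1.2.2 hv r.2.2, (C.glue_mem_domain r.1 r.2).2 r.1.2.2⟩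
  left_inv q := Subtype.ext ((glue_base q.2.2 _).trans (glue_perp q.2.2))
  right_inv r := Prod.ext (base_glue r.1 r.2 ((C.glue_mem_domain r.1 r.2).2 r.1.2.2))
    (Subtype.ext (perp_glue r.1.2.2 r.2))
  isMorphism_toFun := isMorphism_of_isMorphismAt fun q =>
    have hval := (isMorphismAt_id q).val
    .prodMk (isMorphismAt_base hval fun q => q.2.2) (.of_val (isMorphismAt_perp hval q.2.2))
  isMorphism_invFun := isMorphism_of_isMorphismAt fun r =>
    have hid := isMorphismAt_id r
    .of_val (isMorphismAt_glue hid.fst.val r.1.2.2 hid.snd.val)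

theorem isoE_image_stratum (hv : v₀ ≤ v) {u : I₀ ⊕ I₁ → ℕ} (hu : v₀ ≤ u) :
    (C.isoE hv).toFun '' {q | (q : RepSpace Ω w) ∈ Stratum Ω u w} =
      {r | (r.2 : RepSpace Ω wP) ∈ Stratum Ω (u - v₀) wP} := by
  ext r
  constructor
  · rintro ⟨q, hq, rfl⟩
    exact perp_mem_stratum q.2.2 hq
  · exact fun hr =>
      ⟨(C.isoE hv).invFun r, glue_mem_stratum r.1.2.2 hu hr, (C.isoE hv).right_inv r⟩

end SliceChart

end QuiverVariety

namespace QuiverVariety.SliceChart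

open Sum Matrix SpaceWithFunctions

variable {I₀ I₁ : Type*} {Ω : I₁ → I₀ → Type*} [Fintype I₀] [Fintype I₁]
  [∀ β α, Fintype (Ω β α)] [DecidableEq I₀] [DecidableEq I₁] [∀ β α, DecidableEq (Ω β α)]
  {v v₀ : I₀ ⊕ I₁ → ℕ} {w wP : FrameDim (I₀ ⊕ I₁)} {C : SliceChart Ω v₀ w wP}
  {z : RepSpace Ω w × GrProd Ω v w} {q : RepSpace Ω w} {Y : GrProd Ω (v - v₀) wP}

theorem range_sinkReduction_inc_le (hz : z ∈ Ftilde Ω v w) (hq : z.1 ∈ C.domain) (α : I₀) :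
    LinearMap.range (C.sinkReduction z.1 α).inc.mulVecLin ≤ (z.2.1 α).space :=
  (sinkReduction_reduces hq α).range_inc_le.trans (hz.2.1 α)

theorem range_sourceReduction_inc_le (hz : z ∈ Ftilde Ω v w) (hq : z.1 ∈ C.domain) (β : I₁) :
    LinearMap.range (C.sourceReduction z.1 β).inc.mulVecLin ≤ (z.2.2 β).space :=
  (sourceReduction_reduces hq β).range_inc_le.trans (hz.2.2 β)

/-- The images of the subspaces `X_i` under the reductions to the slice. -/
noncomputable def grPerp (hz : z ∈ Ftilde Ω v w) (hq : z.1 ∈ C.domain) : GrProd Ω (v - v₀) wP :=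
  (fun α => ⟨(z.2.1 α).space.map (C.sinkReduction z.1 α).proj.mulVecLin, by
      have h := (sinkReduction_isExact C z.1 α).finrank_map (range_sinkReduction_inc_le hz hq α)
      rw [(z.2.1 α).finrank_eq, Fintype.card_fin] at h
      exact (Nat.sub_eq_of_eq_add' h.symm).symm⟩,
    fun β => ⟨(z.2.2 β).space.map (C.sourceReduction z.1 β).proj.mulVecLin, by
      have h := (sourceReduction_isExact hq β).finrank_map (range_sourceReduction_inc_le hz hq β)
      rw [(z.2.2 β).finrank_eq, Fintype.card_fin] at h
      exact (Nat.sub_eq_of_eq_add' h.symm).symm⟩)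

theorem perp_grPerp_mem (hz : z ∈ Ftilde Ω v w) (hq : z.1 ∈ C.domain) :
    (C.perp z.1, grPerp hz hq) ∈ Ftilde Ω (v - v₀) wP := by
  have hsink (α : I₀) := (sinkReduction_reduces hq α).range_le_map (hz.2.1 α)
  refine ⟨?_, hsink, fun β => (sourceReduction_reduces hq β).range_le_map (hz.2.2 β)⟩
  rintro β _ ⟨ξ, hξ, rfl⟩ α h
  have hmem := Submodule.sub_mem _ (Submodule.mem_map_of_mem (hz.1 β ξ hξ α h))
    (hsink α (sinkReduction_sub_sourceReduction_mem hq h ξ))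
  rwa [mulVecLin_apply, sub_sub_cancel] at hmem

/-- The preimages of subspaces of the slice under the reductions. -/
noncomputable def grGlue (hv : v₀ ≤ v) (hq : q ∈ C.domain) (Y : GrProd Ω (v - v₀) wP) :
    GrProd Ω v w :=
  (fun α => ⟨(Y.1 α).space.comap (C.sinkReduction q α).proj.mulVecLin, by
      rw [(sinkReduction_isExact C q α).finrank_comap, (Y.1 α).finrank_eq, Fintype.card_fin]
      exact Nat.add_sub_cancel' (hv _)⟩,
    fun β => ⟨(Y.2 β).space.comap (C.sourceReduction q β).proj.mulVecLin, by
      rw [(sourceReduction_isExact hq β).finrank_comap, (Y.2 β).finrank_eq, Fintype.card_fin]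
      exact Nat.add_sub_cancel' (hv _)⟩)

theorem grGlue_mem (hv : v₀ ≤ v) (hq : q ∈ C.domain) (hY : (C.perp q, Y) ∈ Ftilde Ω (v - v₀) wP) :
    (q, grGlue hv hq Y) ∈ Ftilde Ω v w := by
  refine ⟨fun β ξ hξ α h => ?_, fun α => (sinkReduction_reduces hq α).range_le_comap (hY.2.1 α),
    fun β => (sourceReduction_reduces hq β).range_le_comap (hY.2.2 β)⟩
  have hmem := Submodule.add_mem _ (hY.2.1 α (sinkReduction_sub_sourceReduction_mem hq h ξ))
    (hY.1 β _ hξ α h)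
  rwa [mulVecLin_apply, sub_add_cancel] at hmem

theorem grGlue_grPerp (hv : v₀ ≤ v) (hz : z ∈ Ftilde Ω v w) (hq : z.1 ∈ C.domain) :
    grGlue hv hq (grPerp hz hq) = z.2 :=
  Prod.ext
    (funext fun α => Gr.ext
      ((sinkReduction_isExact C z.1 α).comap_map (range_sinkReduction_inc_le hz hq α)))
    (funext fun β => Gr.ext
      ((sourceReduction_isExact hq β).comap_map (range_sourceReduction_inc_le hz hq β)))

theorem grPerp_grGlue (hv : v₀ ≤ v) (hq : q ∈ C.domain)
    (hY : (C.perp q, Y) ∈ Ftilde Ω (v - v₀) wP) : grPerp (grGlue_mem hv hq hY) hq = Y :=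
  Prod.ext (funext fun α => Gr.ext ((sinkReduction_isExact C q α).map_comap _))
    (funext fun β => Gr.ext ((sourceReduction_isExact hq β).map_comap _))

theorem grGlue_congr (hv : v₀ ≤ v) {q' : RepSpace Ω w} (h : q = q') (hq : q ∈ C.domain)
    (hq' : q' ∈ C.domain) (Y : GrProd Ω (v - v₀) wP) : grGlue hv hq Y = grGlue hv hq' Y := by
  subst h
  rfl

section Regularity

variable {T : Type*} [SpaceWithFunctions T] {t : T}

theorem isMorphismAt_grPerp {Z : T → RepSpace Ω w × GrProd Ω v w} (hZ : IsMorphismAt Z t)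
    (hmem : ∀ y, Z y ∈ Ftilde Ω v w) (hdom : ∀ y, (Z y).1 ∈ C.domain) :
    IsMorphismAt (fun y => grPerp (hmem y) (hdom y)) t :=
  .prodMk
    (isMorphismAt_pi_iff.2 fun α => .gr_map (isMorphismAt_pi_iff.1 hZ.snd.fst α)
      (isRegularAt_sinkReduction hZ.fst (hdom t) α).proj fun _ => rfl)
    (isMorphismAt_pi_iff.2 fun β => .gr_map (isMorphismAt_pi_iff.1 hZ.snd.snd β)
      (isRegularAt_sourceReduction hZ.fst (hdom t) β).proj fun _ => rfl)

theorem isMorphismAt_grGlue (hv : v₀ ≤ v) {Q : T → RepSpace Ω w} (hQ : IsMorphismAt Q t)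
    (hdom : ∀ y, Q y ∈ C.domain) {Y : T → GrProd Ω (v - v₀) wP} (hY : IsMorphismAt Y t) :
    IsMorphismAt (fun y => grGlue hv (hdom y) (Y y)) t :=
  have hsink := isRegularAt_sinkReduction hQ (hdom t)
  have hsource := isRegularAt_sourceReduction hQ (hdom t)
  .prodMk
    (isMorphismAt_pi_iff.2 fun α => .gr_comap (isMorphismAt_pi_iff.1 hY.fst α)
      (hsink α).inc (hsink α).sec (fun _ => sinkReduction_isExact C _ α) fun _ => rfl)
    (isMorphismAt_pi_iff.2 fun β => .gr_comap (isMorphismAt_pi_iff.1 hY.snd β)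
      (hsource β).inc (hsource β).sec (fun y => sourceReduction_isExact (hdom y) β) fun _ => rfl)

end Regularity

variable (C) in
/-- The open subset `π⁻¹(openE v)` of `Ftilde Ω v w`. -/
abbrev OpenFtilde (v : I₀ ⊕ I₁ → ℕ) :=
  {z : Ftilde Ω v w // (proj z : RepSpace Ω w) ∈ C.openE v}

theorem perp_glue_mem (r : C.openStratum × Ftilde Ω (v - v₀) wP) :
    (C.perp (C.glue r.1.1 r.2.1.1), r.2.1.2) ∈ Ftilde Ω (v - v₀) wP := by
  rw [perp_glue r.1.2.2]
  exact r.2.2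

/-- The point of `Ftilde Ω v w` with given components in the stratum and in the slice. -/
noncomputable def glueFtilde (hv : v₀ ≤ v) (r : C.openStratum × Ftilde Ω (v - v₀) wP) :
    C.OpenFtilde v :=
  have hdom := (C.glue_mem_domain r.1.1 r.2.1.1).2 r.1.2.2
  ⟨⟨(C.glue r.1 r.2.1.1, grGlue hv hdom r.2.1.2), grGlue_mem hv hdom (perp_glue_mem r)⟩,
    glue_mem_E r.1.2.2 hv (proj r.2).2, hdom⟩

/-- The product decomposition of `π⁻¹(openE v)`, which covers `isoE`. -/
noncomputable def isoFtilde (C : SliceChart Ω v₀ w wP) (hv : v₀ ≤ v) :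
    Iso (C.OpenFtilde v) (C.openStratum × Ftilde Ω (v - v₀) wP) where
  toFun z := (base z.2.2, ⟨(C.perp z.1.1.1, grPerp z.1.2 z.2.2), perp_grPerp_mem z.1.2 z.2.2⟩)
  invFun := glueFtilde hv
  left_inv z :=
    have hglue := (glue_base z.2.2 _).trans (glue_perp z.2.2)
    have hdom := (C.glue_mem_domain _ _).2 (base z.2.2).2.2
    Subtype.ext (Subtype.ext (Prod.ext hglue
      ((grGlue_congr hv hglue hdom z.2.2 _).trans (grGlue_grPerp hv z.1.2 z.2.2))))
  right_inv r :=
    have hdom := (C.glue_mem_domain r.1.1 r.2.1.1).2 r.1.2.2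
    Prod.ext (base_glue r.1 r.2.1.1 hdom) (Subtype.ext (Prod.ext (perp_glue r.1.2.2 _)
      (grPerp_grGlue hv hdom (perp_glue_mem r))))
  isMorphism_toFun := isMorphism_of_isMorphismAt fun z =>
    have hval := (isMorphismAt_id z).val.val
    .prodMk (isMorphismAt_base hval.fst fun z => z.2.2) (.of_val
      ((isMorphismAt_perp hval.fst z.2.2).prodMk
        (isMorphismAt_grPerp hval (fun z => z.1.2) fun z => z.2.2)))
  isMorphism_invFun := isMorphism_of_isMorphismAt fun r =>
    have hid := isMorphismAt_id r
    have hglue := isMorphismAt_glue hid.fst.val r.1.2.2 hid.snd.val.fst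
    .of_val (.of_val (hglue.prodMk (isMorphismAt_grGlue hv hglue
      (fun r => (C.glue_mem_domain r.1.1 r.2.1.1).2 r.1.2.2) hid.snd.val.snd)))

end QuiverVariety.SliceChart

/-! ### Existence of slice charts -/

section AdaptedCoordinates

open Matrix

variable {K m n : Type*} [Field K] [Fintype n]

theorem exists_equiv_surjective_rows [Finite m] {d : ℕ} (A : Matrix m n K) (hA : A.rank = d) :
    ∃ b, ∃ e : Fin d ⊕ Fin b ≃ m, Function.Surjective (A.submatrix (e ∘ Sum.inl) id).mulVec ∧
      ∃ T : Matrix m (Fin d) K, A = T * A.submatrix (e ∘ Sum.inl) id := by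
  obtain ⟨r, T, hr, hT⟩ := exists_linearIndependent_rows A hA
  obtain ⟨b, e, he⟩ := exists_sum_equiv (Function.Injective.of_comp (f := A.row) hr.injective)
  obtain rfl : e ∘ Sum.inl = r := funext he
  exact ⟨b, e, surjective_mulVec_of_linearIndependent_row hr, T, hT⟩

end AdaptedCoordinates

namespace QuiverVariety

open Sum Matrix

variable {I₀ I₁ : Type*} {Ω : I₁ → I₀ → Type*} [Fintype I₀] [Fintype I₁]
  [∀ β α, Fintype (Ω β α)] {v₀ d : I₀ ⊕ I₁ → ℕ} {w wP : FrameDim (I₀ ⊕ I₁)}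
  {p : RepSpace Ω w}

/-- The core coordinates of `W_i` are chosen for `p` so that the core rows of `A_α` form a basis
of its row space and the core columns of `A_β` form a basis of its column space. -/
structure CoordSplit.IsAdapted (C : CoordSplit v₀ d w) (p : RepSpace Ω w) : Prop where
  sink_surjective : ∀ α, Function.Surjective
    ((sinkMatrix p α).submatrix (C.equiv (inl α) ∘ inl) id).mulVec
  sink_factor : ∀ α, ∃ T : Matrix (Fin (w.dim (inl α))) (Fin (v₀ (inl α))) ℂ,
    sinkMatrix p α = T * (sinkMatrix p α).submatrix (C.equiv (inl α) ∘ inl) id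
  source_surjective : ∀ β, Function.Surjective
    ((sourceMatrix p β)ᵀ.submatrix (C.equiv (inr β) ∘ inl) id).mulVec
  source_factor : ∀ β, ∃ T : Matrix (Fin (w.dim (inr β))) (Fin (v₀ (inr β))) ℂ,
    (sourceMatrix p β)ᵀ = T * (sourceMatrix p β)ᵀ.submatrix (C.equiv (inr β) ∘ inl) id

theorem exists_coordSplit_isAdapted (hp : p ∈ Stratum Ω v₀ w) :
    ∃ d, ∃ C : CoordSplit v₀ d w, C.IsAdapted p := by
  choose b e he hT using fun α : I₀ =>
    exists_equiv_surjective_rows (sinkMatrix p α) (hp (inl α))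
  choose b' e' he' hT' using fun β : I₁ =>
    exists_equiv_surjective_rows (sourceMatrix p β)ᵀ ((rank_transpose _).trans (hp (inr β)))
  exact ⟨Sum.elim b b', ⟨fun | inl α => e α | inr β => e' β⟩, he, hT, he', hT'⟩

namespace CoordSplit.IsAdapted

variable {C : CoordSplit v₀ d w}

theorem sinkCore_surjective (h : C.IsAdapted p) (α : I₀) :
    Function.Surjective (C.sinkCore p α).mulVec := by
  refine surjective_mulVec_of_col_mem (h.sink_surjective α) ?_
  rw [range_mulVecLin]
  rintro (j | ⟨β, a, j⟩)
  · exact Submodule.subset_span ⟨inl j, rfl⟩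
  -- The columns of `y_h` are combinations of those in the core coordinates at the source of `h`.
  · obtain ⟨T, hT⟩ := h.source_factor β
    have hcol : ((sinkMatrix p α).submatrix (C.equiv (inl α) ∘ inl) id).col (inr ⟨β, a, j⟩) =
        ∑ k, T j k • (C.sinkCore p α).col (sinkIncl w a k) := by
      ext i
      rw [Finset.sum_apply]
      exact congrFun (congrFun hT j) (inr ⟨α, a, C.equiv (inl α) (inl i)⟩)
    rw [hcol]
    exact Submodule.sum_mem _ fun k _ => Submodule.smul_mem _ _ (Submodule.subset_span ⟨_, rfl⟩)

theorem sourceCore_transpose_surjective (h : C.IsAdapted p) (β : I₁) :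
    Function.Surjective (C.sourceCore p β)ᵀ.mulVec := by
  refine surjective_mulVec_of_col_mem (h.source_surjective β) ?_
  rw [range_mulVecLin]
  rintro (j | ⟨α, a, j⟩)
  · exact Submodule.subset_span ⟨inl j, rfl⟩
  · obtain ⟨T, hT⟩ := h.sink_factor α
    have hcol : ((sourceMatrix p β)ᵀ.submatrix (C.equiv (inr β) ∘ inl) id).col (inr ⟨α, a, j⟩) =
        ∑ k, T j k • (C.sourceCore p β)ᵀ.col (sourceIncl w a k) := by
      ext i
      rw [Finset.sum_apply]
      exact congrFun (congrFun hT j) (inr ⟨β, a, C.equiv (inr β) (inl i)⟩)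
    rw [hcol]
    exact Submodule.sum_mem _ fun k _ => Submodule.smul_mem _ _ (Submodule.subset_span ⟨_, rfl⟩)

end CoordSplit.IsAdapted

variable [DecidableEq I₀] [DecidableEq I₁] [∀ β α, DecidableEq (Ω β α)]

theorem SliceChart.perpDim_eq_sub_Cq (C : SliceChart Ω v₀ w wP) (i : I₀ ⊕ I₁) :
    ((wP.dim i : ℤ), (wP.dim' i : ℤ)) = ((w.dim i : ℤ), (w.dim' i : ℤ)) - Cq Ω v₀ i := by
  have hdim : v₀ i + wP.dim i = w.dim i := by simpa using Fintype.card_congr (C.equiv i)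
  rcases i with α | β
  · have hcard := (C.sink_isExact α).card_eq
    simp only [Fintype.card_sum, Fintype.card_sigma, Fintype.card_fin] at hcard
    zify at hdim hcard
    exact Prod.ext (eq_sub_of_add_eq' hdim) (by simp only [Cq, Prod.snd_sub]; linarith)
  · have hcard := (C.source_isExact β).card_eq
    simp only [Fintype.card_sum, Fintype.card_sigma, Fintype.card_fin] at hcard
    zify at hdim hcard
    exact Prod.ext (eq_sub_of_add_eq' hdim) (by simp only [Cq, Prod.snd_sub]; linarith)

theorem exists_sliceChart (hp : p ∈ Stratum Ω v₀ w) :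
    ∃ wP, ∃ C : SliceChart Ω v₀ w wP, p ∈ C.domain := by
  obtain ⟨d, C, hC⟩ := exists_coordSplit_isAdapted hp
  choose b s hs hproj using fun α : I₀ =>
    Splitting.exists_isExact_proj_eq (hC.sinkCore_surjective α)
  choose b' s' hs' hproj' using fun β : I₁ =>
    Splitting.exists_isExact_proj_eq (hC.sourceCore_transpose_surjective β)
  refine ⟨⟨d, Sum.elim b b'⟩, ⟨C, s, hs, fun β => (s' β).transpose, fun β => (hs' β).transpose⟩,
    fun α => ?_, fun β => ?_⟩
  · change IsUnit (C.sinkCore p α * (s α).sec).det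
    rw [← hproj, (hs α).proj_mul_sec, det_one]
    exact isUnit_one
  · change IsUnit ((s' β).secᵀ * C.sourceCore p β).det
    rw [← transpose_transpose (C.sourceCore p β), ← transpose_mul, ← hproj', (hs' β).proj_mul_sec,
      transpose_one, det_one]
    exact isUnit_one

end QuiverVariety

open QuiverVariety SpaceWithFunctions in
theorem lemma4p3 {I₀ I₁ : Type*} [Fintype I₀] [Fintype I₁] (Ω : I₁ → I₀ → Type*)
    [∀ β α, Fintype (Ω β α)] (v v₀ : I₀ ⊕ I₁ → ℕ) (w : FrameDim (I₀ ⊕ I₁))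
    (p : RepSpace Ω w) (hp : p ∈ E Ω v w) (hp₀ : p ∈ Stratum Ω v₀ w) :
    v₀ ≤ v ∧
    ∃ wPerp : FrameDim (I₀ ⊕ I₁),
      (∀ i, ((wPerp.dim i : ℤ), (wPerp.dim' i : ℤ)) = ((w.dim i : ℤ), (w.dim' i : ℤ)) - Cq Ω v₀ i) ∧
    ∃ U U₀ : Set (RepSpace Ω w),
      (U ⊆ E Ω v w ∧ IsZariskiOpen {q : E Ω v w | (q : RepSpace Ω w) ∈ U}) ∧
      (U₀ ⊆ Stratum Ω v₀ w ∧ IsZariskiOpen {q : Stratum Ω v₀ w | (q : RepSpace Ω w) ∈ U₀}) ∧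
      (∀ c : ℂ, c ≠ 0 → ∀ q ∈ U, c • q ∈ U) ∧
      (∀ c : ℂ, c ≠ 0 → ∀ q ∈ U₀, c • q ∈ U₀) ∧
    ∃ (hU : p ∈ U) (hU₀ : p ∈ U₀)
      (φ : Iso {z : Ftilde Ω v w // (proj z : RepSpace Ω w) ∈ U} (U₀ × Ftilde Ω (v - v₀) wPerp))
      (ψ : Iso U (U₀ × E Ω (v - v₀) wPerp)),
      (∀ z, ψ.toFun ⟨proj z.1, z.2⟩ = ((φ.toFun z).1, proj (φ.toFun z).2)) ∧
      ((ψ.toFun ⟨p, hU⟩).1 = ⟨p, hU₀⟩ ∧ ((ψ.toFun ⟨p, hU⟩).2 : RepSpace Ω wPerp) = 0) ∧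
      ∀ u : I₀ ⊕ I₁ → ℕ, v₀ ≤ u → u ≤ v →
        ψ.toFun '' {q : U | (q : RepSpace Ω w) ∈ Stratum Ω u w} =
          {r : U₀ × E Ω (v - v₀) wPerp | (r.2 : RepSpace Ω wPerp) ∈ Stratum Ω (u - v₀) wPerp} := by
  classical
  have hv : v₀ ≤ v := fun i => (hp₀ i).symm.le.trans (hp i)
  obtain ⟨wPerp, C, hC⟩ := exists_sliceChart hp₀
  refine ⟨hv, wPerp, C.perpDim_eq_sub_Cq, C.openE v, C.openStratum,
    ⟨Set.inter_subset_left, C.isZariskiOpen_domain _⟩,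
    ⟨Set.inter_subset_left, C.isZariskiOpen_domain _⟩,
    fun c hc q hq => ⟨fun i => ?_, C.smul_mem_domain hc hq.2⟩,
    fun c hc q hq => ⟨fun i => ?_, C.smul_mem_domain hc hq.2⟩,
    ⟨hp, hC⟩, ⟨hp₀, hC⟩, C.isoFtilde hv, C.isoE hv, fun z => rfl,
    ⟨SliceChart.base_eq_self ⟨hp₀, hC⟩, (SliceChart.mem_stratum_iff hC).1 hp₀⟩,
    fun u hu _ => SliceChart.isoE_image_stratum hv hu⟩
  · exact (congrFun (rankA_smul hc q) i).le.trans (hq.1 i)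
  · exact (congrFun (rankA_smul hc q) i).trans (hq.1 i)
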